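/- **Setting.** Let $G=(V\cup V^+,E)$ be a finite unweighted graph with terminal set $V$, $n=|V|$, in which every node of $V^+$ has degree $2$. For each $u\in V$ let $T_u\subseteq G$ be a tree containing all of $V$. Write $P_u(v,w)$ for the path between $v$ and $w$ in $T_u$ (identified with its edge set), $P_u(v)=P_u(u,v)$, and $d_u(v)=|P_u(v)|$. Assume that $P_u(v)=P_v(u)$ for all $u,v\in V$ and that $|P_u(v,w)|$ is a multiple of $12$ for all $u,v,w\in V$. Let $D=\max_{u,v\in V}d_u(v)$. Root $T_u$ at $u$ and let $\mathrm{reach}_{T_u}(v)$ be the largest distance in $T_u$ from $v$ to a descendant of $v$. Let $V_u^*$ be the set of nodes $v$ of $T_u$ with $\mathrm{reach}_{T_u}(v)\ge \frac12 d_u(v)$ and let $\mathrm{cut}_u^{*(r)}=\{v\in V_u^*: d_u(v)=r\}$. Give the edges $e\in E$ independent values $\rho(e)$, uniform on $[0,1]$ (almost surely distinct). For $u\ne v$ in $V$ let $P_u'(v)=P_u(u',v')$, where $u',v'$ are the nodes of $P_u(v)$ with $d_u(u')=\frac5{12}d_u(v)$ and $d_u(v')=\frac7{12}d_u(v)$,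 and let $\eta_u(v)$ be the edge of $P'_u(v)$ with the smallest value of $\rho$. The edge hub set of $u$ is $S(u)=\{\eta_u(v): v\in V,\ v\neq u\}$. Let $r^{[i]}=\left\lceil 15\left(\frac{16}{15}\right)^i\right\rceil$. **Theorem.** There are non-negative integers $l_i(u)$ ($u\in V$, $i\ge1$), which do not depend on $\rho$, with $$l_i(u)\le 2\min_{r^{[i+1]}\le r\le r^{[i+2]}}\bigl|\mathrm{cut}_u^{*(r)}\bigr| ,$$ such that, with probability at least $1-8/n$, all nodes $u\in V$ satisfy $$|S(u)|\le 2\sum_{r=0}^{19}\bigl|\mathrm{cut}_u^{*(r)}\bigr|+24\ln n+2\max_{(\gamma_i)}\ \sum_{i=1}^{\lfloor 16\ln D\rfloor} l_i(u)\ln\gamma_i ,$$ where the maximum is over all families of positive integers $(\gamma_i)_{1\le i\le\lfloor16\ln D\rfloor}$ with $\sum_i\gamma_i<2112\ln D+528\ln n$. -/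

import Mathlib

open MeasureTheory

/-- The edge set of a path between `a` and `b` in the subgraph `T`; when `T` is a tree containing
`a` and `b` this is the edge set of the unique such path. -/
def pathEdges {W : Type*} {G : SimpleGraph W} (T : G.Subgraph) (a b : W) : Set (Sym2 W) :=
  {e | ∃ p : T.spanningCoe.Walk a b, p.IsPath ∧ e ∈ p.edges}

/-- The nodes of the path between `a` and `b` in the tree `T`. -/
def pathVerts {W : Type*} {G : SimpleGraph W} (T : G.Subgraph) (a b : W) : Set W :=
  {x | ∃ p : T.spanningCoe.Walk a b, p.IsPath ∧ x ∈ p.support}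

/-- The number of edges of the path between `a` and `b` in the tree `T`. -/
noncomputable def treeDist {W : Type*} {G : SimpleGraph W} (T : G.Subgraph) (a b : W) : ℕ :=
  T.spanningCoe.dist a b

/-- An unweighted finite graph on `V ∪ V⁺` with terminal set `V`, all nodes of `V⁺` (the
complement of `V`) having degree two, together with a tree `T u ⊆ G` for each terminal `u`, such
that `P_u(v) = P_v(u)` and all tree distances between terminals are multiples of `12`. -/
structure HubNetwork (W : Type*) where
  /-- the graph -/
  G : SimpleGraph W
  /-- the terminals -/
  V : Finset W
  degree_two : ∀ x : W, x ∉ V → (G.neighborSet x).ncard = 2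
  /-- the tree of each terminal -/
  T : V → G.Subgraph
  isTree : ∀ u : V, (T u).coe.IsTree
  terminal_mem : ∀ u v : V, (v : W) ∈ (T u).verts
  path_symm : ∀ u v : V, pathEdges (T u) u v = pathEdges (T v) v u
  twelve_dvd : ∀ u v w : V, 12 ∣ treeDist (T u) v w

/-- `x` is a node of `T` and `v` lies on the path from the root `u` to `x`. -/
def IsDescendant {W : Type*} {G : SimpleGraph W} (T : G.Subgraph) (u v x : W) : Prop :=
  x ∈ T.verts ∧ v ∈ pathVerts T u x

open Classical in
/-- The largest distance from `v` to a descendant of `v` in the tree `T` rooted at `u`. -/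
noncomputable def reach {W : Type*} [Fintype W] {G : SimpleGraph W} (T : G.Subgraph) (u v : W) :
    ℕ :=
  (Finset.univ.filter fun x => IsDescendant T u v x).sup fun x => treeDist T v x

/-- The node set of the skeleton of `T` rooted at `u`: the nodes whose reach is at least half of
their distance from the root. -/
def skeletonVerts {W : Type*} [Fintype W] {G : SimpleGraph W} (T : G.Subgraph) (u : W) : Set W :=
  {v | v ∈ T.verts ∧ (treeDist T u v : ℝ) / 2 ≤ reach T u v}

namespace HubNetwork

variable {W : Type*} [Fintype W] (N : HubNetwork W)

open Classical in
/-- The nodes of the skeleton of `T u` at distance `r` from `u`. -/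
noncomputable def cut (u : N.V) (r : ℕ) : Finset W :=
  Finset.univ.filter fun v => v ∈ skeletonVerts (N.T u) u ∧ treeDist (N.T u) u v = r

/-- The edges of the central subpath of `P_u(v)`: the part of it between the nodes at distances
`(5/12) d_u(v)` and `(7/12) d_u(v)` from `u`. -/
def centralEdges (u v : N.V) : Set (Sym2 W) :=
  {e | ∃ a ∈ pathVerts (N.T u) u v, ∃ b ∈ pathVerts (N.T u) u v,
    12 * treeDist (N.T u) u a = 5 * treeDist (N.T u) u v ∧
    12 * treeDist (N.T u) u b = 7 * treeDist (N.T u) u v ∧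
    e ∈ pathEdges (N.T u) a b}

/-- The edge hub set `S(u)`: for each terminal `v ≠ u`, the edge of minimum value on the central
subpath of `P_u(v)` (unique for all `ρ` with distinct values, that is, almost surely). -/
def hubSet (ρ : N.G.edgeSet → unitInterval) (u : N.V) : Set N.G.edgeSet :=
  {η | ∃ v : N.V, v ≠ u ∧ (η : Sym2 W) ∈ N.centralEdges u v ∧
    ∀ e : N.G.edgeSet, (e : Sym2 W) ∈ N.centralEdges u v → ρ η ≤ ρ e}

open Classical in
/-- The law of independent uniform values in `[0, 1]` on the edges. -/
noncomputable def edgeLaw : Measure (N.G.edgeSet → unitInterval) :=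
  Measure.pi fun _ => volume

/-- The diameter: the largest distance `d_u(v)` between terminals. -/
noncomputable def diam : ℕ :=
  Finset.univ.sup fun u : N.V => Finset.univ.sup fun v : N.V => treeDist (N.T u) u v

end HubNetwork

/-- The radii `⌈15 (16/15)^i⌉`. -/
noncomputable def layerRadius (i : ℕ) : ℕ := ⌈15 * (16 / 15 : ℝ) ^ i⌉₊

/-- The index set `1, 2, …, ⌊16 ln D⌋`. -/
noncomputable def layerIndices (D : ℕ) : Finset ℕ := Finset.Icc 1 ⌊16 * Real.log D⌋₊

/-- The families of positive integers `γ i` with `∑ γ i < 2112 ln D + 528 ln n`. -/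
def admissibleFamilies (D n : ℕ) : Set (ℕ → ℕ) :=
  {γ | (∀ i ∈ layerIndices D, 0 < γ i) ∧
    ∑ i ∈ layerIndices D, (γ i : ℝ) < 2112 * Real.log D + 528 * Real.log n}

/-- The maximum of `∑ l i * ln (γ i)` over the admissible families `γ`; only finitely many values
of `γ` on the index set are admissible, so that the supremum is attained. -/
noncomputable def maxLogSum (D n : ℕ) (l : ℕ → ℕ) : ℝ :=
  sSup ((fun γ : ℕ → ℕ => ∑ i ∈ layerIndices D, (l i : ℝ) * Real.log (γ i)) ''
    admissibleFamilies D n)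

/-! Every hub edge of depth at least 20 is a record. If it lies in the farther half of its central
subpath, then the edges met just before it on the walk away from the root, back through the whole
preceding layer, are still central, so its value is least among them. In the nearer half the same
holds for the walk towards the root and the following layer. Hence each such edge is a record of one
of two systems, `down` and `up`, whose paths in layer `i` lead to the nodes of one smallest cut
(`mem_of_mem_hubSet`). Shallower hub edges are counted by their lower endpoints, which lie in the
small cuts.

Records on all paths of a tree are counted together by a supermartingale. A path with `b` unexplored
body edges and current minimum `m` carries the potential `1 + b m`, and each record doubles the
weight. The identity `∫ (2 if x ≤ m, else 1) (1 + (b - 1) min x m) dx = 1 + b m` shows that the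
potential pays for the doubling. An edge shared by many paths counts once, and only the path with
the largest minimum has to pay; the other potentials cannot grow. So `weight` has mean at most 1
(`lintegral_weight_le_one`). All final potentials are 1, so Markov's inequality bounds `2 ^ records`
by `n²` times the product of the initial potentials. Concavity of the logarithm turns this into `∑
kᵢ ln (1 + Mᵢ)`, where `Mᵢ` averages, over the `kᵢ` paths of layer `i`, the body length times the
base minimum.

Bases and bodies have comparable lengths, so `E exp (Mᵢ / 8) ≤ 2`. Bases of different layers are
disjoint, so the `Mᵢ` are independent and a Chernoff bound controls `∑ Mᵢ`. Rounding the `Mᵢ` of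
both systems up to integers gives an admissible family. For each terminal there are two systems with
two failure events of probability at most `1/n²` each, so the total failure probability is at most
`4/n`. -/

/-! ### Minima of uniform values and the one-step integral -/

/-- The smallest value of `ρ` on `S`, and `1` when `S` is empty. -/
noncomputable def leastValue {E : Type*} (S : Finset E) (ρ : E → unitInterval) : unitInterval := S.inf ρ

lemma leastValue_congr {E : Type*} {S : Finset E} {ρ ρ' : E → unitInterval}
    (h : ∀ f ∈ S, ρ f = ρ' f) : leastValue S ρ = leastValue S ρ' := Finset.inf_congr rfl h

lemma le_leastValue_iff {E : Type*} {S : Finset E} {ρ : E → unitInterval} {x : unitInterval} :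
    x ≤ leastValue S ρ ↔ ∀ f ∈ S, x ≤ ρ f := Finset.le_inf_iff

lemma measurable_leastValue {E : Type*} (S : Finset E) : Measurable (leastValue S) := by
  classical
  induction S using Finset.induction_on with
  | empty =>
    have : leastValue (∅ : Finset E) = fun _ => 1 := rfl
    rw [this]; exact measurable_const
  | insert a S _ ih =>
    have : leastValue (insert a S) = fun ρ => ρ a ⊓ leastValue S ρ := by
      funext ρ; exact Finset.inf_insert
    rw [this]
    exact (measurable_pi_apply a).inf ih

lemma leastValue_insert_update {E : Type*} [DecidableEq E] {S : Finset E} {a : E} (ha : a ∉ S)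
    (ρ : E → unitInterval) (x : unitInterval) :
    leastValue (insert a S) (Function.update ρ a x) = x ⊓ leastValue S ρ := by
  unfold leastValue
  rw [Finset.inf_insert, Function.update_self]
  congr 1
  refine Finset.inf_congr rfl fun f hf => ?_
  rw [Function.update_of_ne]
  rintro rfl; exact ha hf

/-- One exploration step: the bonus for undercutting the threshold `m` is paid by the linear
potential. -/
lemma lintegral_record_step (m : unitInterval) {b : ℝ} (hb : 0 ≤ b) :
    ∫⁻ x : unitInterval, ENNReal.ofReal ((if x ≤ m then 2 else 1) * (1 + b * min (x : ℝ) m)) =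
      ENNReal.ofReal (1 + (b + 1) * m) := by
  have hm0 := m.2.1
  have hm1 := m.2.2
  set g : ℝ → ℝ := fun x => if x ≤ m then 2 * (1 + b * x) else 1 + b * m with hg
  have hgm : Measurable g := by
    refine Measurable.ite measurableSet_Iic (by fun_prop) measurable_const
  have key : ∫⁻ x : unitInterval,
      ENNReal.ofReal ((if x ≤ m then 2 else 1) * (1 + b * min (x : ℝ) m)) =
      ∫⁻ x in Set.Icc (0 : ℝ) 1, ENNReal.ofReal (g x) := by
    rw [← lintegral_subtype_comap measurableSet_Icc (fun x => ENNReal.ofReal (g x))]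
    refine lintegral_congr fun x => ?_
    congr 1
    simp only [hg, ← Subtype.coe_le_coe]
    split_ifs with h
    · rw [min_eq_left h]
    · rw [min_eq_right (le_of_not_ge h), one_mul]
  have h1 : IntervalIntegrable g volume 0 m := by
    refine IntervalIntegrable.congr (f := fun x => 2 * (1 + b * x)) (fun x hx => ?_)
      (Continuous.intervalIntegrable (by fun_prop) _ _)
    rw [Set.uIoc_of_le hm0] at hx
    simp [hg, hx.2]
  have h2 : IntervalIntegrable g volume m 1 := by
    refine IntervalIntegrable.congr (f := fun x => 1 + b * m) (fun x hx => ?_)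
      (Continuous.intervalIntegrable (by fun_prop) _ _)
    rw [Set.uIoc_of_le hm1] at hx
    simp [hg, not_le.2 hx.1]
  have e1 : ∫ x in (0:ℝ)..m, g x = 2 * m + b * m ^ 2 := by
    rw [intervalIntegral.integral_congr_Ioo_of_le (g := fun x => 2 * (1 + b * x)) hm0]
    · rw [intervalIntegral.integral_const_mul, intervalIntegral.integral_add
        (Continuous.intervalIntegrable (by fun_prop) _ _)
        (Continuous.intervalIntegrable (by fun_prop) _ _), intervalIntegral.integral_const_mul,
        integral_id]
      simp
      ring
    · intro x hx
      simp [hg, hx.2.le]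
  have e2 : ∫ x in (m:ℝ)..1, g x = (1 - m) * (1 + b * m) := by
    rw [intervalIntegral.integral_congr_Ioo_of_le (g := fun x => 1 + b * m) hm1]
    · rw [intervalIntegral.integral_const, smul_eq_mul]
    · intro x hx
      simp [hg, not_le.2 hx.1]
  have h3 := h1.trans h2
  have h0 : ∀ x ∈ Set.Icc (0:ℝ) 1, 0 ≤ g x := by
    intro x hx
    simp only [hg]
    split_ifs
    · have := mul_nonneg hb hx.1; linarith
    · have := mul_nonneg hb hm0; linarith
  rw [key, setLIntegral_congr (Ioc_ae_eq_Icc (a := (0:ℝ)) (b := 1)).symm,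
    ← ofReal_integral_eq_lintegral_ofReal]
  · rw [← intervalIntegral.integral_of_le zero_le_one,
      ← intervalIntegral.integral_add_adjacent_intervals h1 h2, e1, e2]
    congr 1; ring
  · exact (intervalIntegrable_iff_integrableOn_Ioc_of_le zero_le_one).1 h3
  · refine (ae_restrict_iff' measurableSet_Ioc).2 (Filter.Eventually.of_forall fun x hx => ?_)
    exact h0 x ⟨hx.1.le, hx.2⟩

/-- Integrating out one coordinate. -/
lemma lintegral_pi_le_of_update {E : Type*} [Fintype E] [DecidableEq E]
    {F F' : (E → unitInterval) → ENNReal} (a : E) (hF' : Measurable F')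
    (h : ∀ ρ, ∫⁻ x, F' (Function.update ρ a x) ≤ F ρ) :
    ∫⁻ ρ, F' ρ ∂(Measure.pi fun _ => volume) ≤ ∫⁻ ρ, F ρ ∂(Measure.pi fun _ => volume) := by
  have e : ∫⁻ ρ, F' ρ ∂(Measure.pi fun _ => volume) =
      ∫⁻ ρ, (∫⋯∫⁻_{a}, F' ∂fun _ => (volume : Measure unitInterval)) ρ
        ∂(Measure.pi fun _ => volume) := by
    refine lintegral_eq_of_lmarginal_eq {a} hF' (hF'.lmarginal _) ?_
    funext ρ
    conv_rhs => rw [lmarginal_singleton]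
    simp [lmarginal_update_of_mem]
  rw [e]
  refine lintegral_mono fun ρ => ?_
  rw [lmarginal_singleton]
  exact h ρ

/-! ### Record systems and their supermartingale -/

/-- A finite family of paths, each consisting of a base and a body, such that the base of each path
is explored before its body. -/
structure RecordSystem (E ι : Type*) where
  rank : E → ℤ
  paths : Finset ι
  base : ι → Finset E
  body : ι → Finset E
  base_lt : ∀ w ∈ paths, ∀ a ∈ base w, ∀ b ∈ body w, rank a < rank b
  rank_injOn : ∀ w ∈ paths, Set.InjOn rank (body w : Set E)

namespace RecordSystem

variable {E ι : Type*} (R : RecordSystem E ι)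

/-- The element `e` of the body of some path has a value at most those of all elements of that
path explored before it. -/
def IsRecord (ρ : E → unitInterval) (e : E) : Prop :=
  ∃ w ∈ R.paths, e ∈ R.body w ∧
    ∀ f, f ∈ R.base w ∨ f ∈ R.body w → R.rank f < R.rank e → ρ e ≤ ρ f

open Classical in
/-- The number of records in `S`. -/
noncomputable def recordCount (S : Finset E) (ρ : E → unitInterval) : ℕ :=
  (S.filter fun e => R.IsRecord ρ e).card

open Classical in
/-- The potential of the path `w` after the exploration of `S`. -/
noncomputable def potential (S : Finset E) (ρ : E → unitInterval) (w : ι) : ℝ :=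
  1 + (R.body w \ S).card * (leastValue (R.base w ∪ (R.body w ∩ S)) ρ : ℝ)

/-- The potential of the path `w` before the exploration of its body. -/
noncomputable def initial (ρ : E → unitInterval) (w : ι) : ℝ :=
  1 + (R.body w).card * (leastValue (R.base w) ρ : ℝ)

/-- The weight of an outcome after the exploration of `S`. -/
noncomputable def weight (S : Finset E) (ρ : E → unitInterval) : ℝ :=
  2 ^ R.recordCount S ρ * ∏ w ∈ R.paths, R.potential S ρ w / R.initial ρ w

lemma potential_eq [DecidableEq E] (S : Finset E) (ρ : E → unitInterval) (w : ι) :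
    R.potential S ρ w =
      1 + (R.body w \ S).card * (leastValue (R.base w ∪ (R.body w ∩ S)) ρ : ℝ) := by
  unfold potential; congr!

lemma potential_pos (S : Finset E) (ρ : E → unitInterval) (w : ι) : 0 < R.potential S ρ w := by
  classical
  unfold potential
  have := (leastValue (R.base w ∪ (R.body w ∩ S)) ρ).2.1
  positivity

lemma initial_pos (ρ : E → unitInterval) (w : ι) : 0 < R.initial ρ w := by
  unfold initial
  have := (leastValue (R.base w) ρ).2.1
  positivity

lemma potential_of_disjoint {S : Finset E} {w : ι} (h : Disjoint (R.body w) S)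
    (ρ : E → unitInterval) : R.potential S ρ w = R.initial ρ w := by
  classical
  unfold potential initial
  rw [Finset.sdiff_eq_self_of_disjoint h, Finset.disjoint_iff_inter_eq_empty.1 h,
    Finset.union_empty]

lemma potential_univ [Fintype E] (ρ : E → unitInterval) (w : ι) :
    R.potential Finset.univ ρ w = 1 := by
  classical
  unfold potential
  rw [Finset.sdiff_eq_empty_iff_subset.2 (Finset.subset_univ _)]
  simp

lemma measurableSet_isRecord [Finite E] (e : E) : MeasurableSet {ρ | R.IsRecord ρ e} := by
  have : {ρ | R.IsRecord ρ e} = ⋃ w ∈ (R.paths : Set ι), {_ρ : E → unitInterval | e ∈ R.body w} ∩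
      ⋂ (f) (_ : f ∈ R.base w ∨ f ∈ R.body w) (_ : R.rank f < R.rank e), {ρ | ρ e ≤ ρ f} := by
    ext ρ
    simp only [IsRecord, Set.mem_ofPred_eq, Set.mem_iUnion, Set.mem_inter_iff, Set.mem_iInter,
      Finset.mem_coe, exists_prop]
  rw [this]
  refine MeasurableSet.biUnion R.paths.countable_toSet fun w _ => ?_
  refine (MeasurableSet.const _).inter ?_
  refine MeasurableSet.iInter fun f => MeasurableSet.iInter fun _ => MeasurableSet.iInter fun _ => ?_
  exact measurableSet_le (measurable_pi_apply e) (measurable_pi_apply f)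

lemma measurable_recordCount [Finite E] (S : Finset E) : Measurable (R.recordCount S) := by
  classical
  have : R.recordCount S = fun ρ => ∑ e ∈ S, if R.IsRecord ρ e then 1 else 0 := by
    funext ρ
    rw [recordCount, Finset.card_filter]
  rw [this]
  refine Finset.measurable_sum _ fun e _ => ?_
  exact Measurable.ite (R.measurableSet_isRecord e) measurable_const measurable_const

lemma measurable_initial (w : ι) : Measurable fun ρ => R.initial ρ w := by
  have := measurable_leastValue (R.base w)
  unfold initial
  fun_prop

lemma measurable_weight [Finite E] (S : Finset E) : Measurable (R.weight S) := by
  classical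
  unfold weight
  refine Measurable.mul ?_ (Finset.measurable_prod _ fun w _ => ?_)
  · exact (measurable_from_top (f := fun k : ℕ => (2 : ℝ) ^ k)).comp (R.measurable_recordCount S)
  · refine Measurable.div ?_ (R.measurable_initial w)
    have := measurable_leastValue (R.base w ∪ (R.body w ∩ S))
    unfold potential
    fun_prop

section step

variable {R} [DecidableEq E] {S : Finset E} {a : E} (haS : a ∉ S)
  (hS : ∀ x ∈ S, R.rank x ≤ R.rank a) (ρ : E → unitInterval) (x : unitInterval)

include haS hS

/-- Whether `e` is a record depends only on `e` and on elements of strictly smaller rank, so an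
element of maximal rank does not affect earlier records. -/
lemma isRecord_update_iff {e : E} (he : e ∈ S) :
    R.IsRecord (Function.update ρ a x) e ↔ R.IsRecord ρ e := by
  unfold IsRecord
  refine exists_congr fun w => and_congr_right fun _ => and_congr_right fun _ =>
    forall_congr' fun f => forall_congr' fun _ => forall_congr' fun hf => ?_
  have h1 : e ≠ a := by rintro rfl; exact haS he
  have h2 : f ≠ a := by rintro rfl; exact (hS e he).not_gt hf
  rw [Function.update_of_ne h1, Function.update_of_ne h2]

lemma recordCount_insert_update [Decidable (R.IsRecord (Function.update ρ a x) a)] :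
    R.recordCount (insert a S) (Function.update ρ a x) =
      R.recordCount S ρ + if R.IsRecord (Function.update ρ a x) a then 1 else 0 := by
  classical
  have h : (S.filter fun e => R.IsRecord (Function.update ρ a x) e) =
      S.filter fun e => R.IsRecord ρ e :=
    Finset.filter_congr fun e he => isRecord_update_iff haS hS ρ x he
  unfold recordCount
  rw [Finset.filter_insert]
  split_ifs with hr
  · rw [Finset.card_insert_of_notMem (by simp [haS])]
    rw [h]
  · rw [h]; simp

/-- If `a` is in the base, the body is still entirely unexplored, so both quotients are 1 although
numerator and denominator change. This is why potentials are divided by their initial values: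
exploring a base is free. -/
lemma potential_div_insert_update_of_notMem {w : ι} (hw : w ∈ R.paths) (ha : a ∉ R.body w) :
    R.potential (insert a S) (Function.update ρ a x) w / R.initial (Function.update ρ a x) w =
      R.potential S ρ w / R.initial ρ w := by
  by_cases hb : a ∈ R.base w
  · have hd : Disjoint (R.body w) S := by
      rw [Finset.disjoint_left]
      intro b hbw hbS
      exact (R.base_lt w hw a hb b hbw).not_ge (hS b hbS)
    have hd' : Disjoint (R.body w) (insert a S) := by
      rw [Finset.disjoint_insert_right]; exact ⟨ha, hd⟩
    rw [potential_of_disjoint _ hd, potential_of_disjoint _ hd',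
      div_self (R.initial_pos _ _).ne', div_self (R.initial_pos _ _).ne']
  · have e1 : R.initial (Function.update ρ a x) w = R.initial ρ w := by
      unfold initial
      rw [leastValue_congr (S := R.base w) (ρ' := ρ)]
      intro f hf
      rw [Function.update_of_ne]; rintro rfl; exact hb hf
    have e2 : R.potential (insert a S) (Function.update ρ a x) w = R.potential S ρ w := by
      classical
      have i1 : R.body w ∩ insert a S = R.body w ∩ S := by
        ext y; simp only [Finset.mem_inter, Finset.mem_insert]
        constructor
        · rintro ⟨h1, rfl | h2⟩
          · exact absurd h1 ha
          · exact ⟨h1, h2⟩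
        · rintro ⟨h1, h2⟩; exact ⟨h1, Or.inr h2⟩
      have i2 : R.body w \ insert a S = R.body w \ S := by
        ext y; simp only [Finset.mem_sdiff, Finset.mem_insert, not_or]
        constructor
        · rintro ⟨h1, _, h2⟩; exact ⟨h1, h2⟩
        · rintro ⟨h1, h2⟩
          refine ⟨h1, ?_, h2⟩
          rintro rfl; exact ha h1
      rw [potential_eq, potential_eq, i1, i2, leastValue_congr (ρ' := ρ)]
      intro f hf
      rw [Function.update_of_ne]; rintro rfl
      simp [hb, ha] at hf
    rw [e1, e2]

lemma initial_update_of_mem {w : ι} (hw : w ∈ R.paths) (ha : a ∈ R.body w) :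
    R.initial (Function.update ρ a x) w = R.initial ρ w := by
  have hb : a ∉ R.base w := fun hb => lt_irrefl _ (R.base_lt w hw a hb a ha)
  unfold initial
  rw [leastValue_congr (S := R.base w) (ρ' := ρ)]
  intro f hf
  rw [Function.update_of_ne]; rintro rfl; exact hb hf

lemma potential_insert_update_of_mem {w : ι} (hw : w ∈ R.paths) (ha : a ∈ R.body w) :
    R.potential (insert a S) (Function.update ρ a x) w =
      1 + (((R.body w \ S).card : ℝ) - 1) *
        min (x : ℝ) (leastValue (R.base w ∪ (R.body w ∩ S)) ρ) := by
  have hb : a ∉ R.base w := fun hb => lt_irrefl _ (R.base_lt w hw a hb a ha)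
  have i1 : R.base w ∪ (R.body w ∩ insert a S) = insert a (R.base w ∪ (R.body w ∩ S)) := by
    ext y; simp only [Finset.mem_inter, Finset.mem_insert, Finset.mem_union]
    constructor
    · tauto
    · rintro (rfl | h)
      · exact Or.inr ⟨ha, Or.inl rfl⟩
      · tauto
  have i2 : R.body w \ insert a S = (R.body w \ S).erase a := by
    ext y; simp only [Finset.mem_sdiff, Finset.mem_insert, Finset.mem_erase]; tauto
  have i3 : ((R.body w \ S).erase a).card + 1 = (R.body w \ S).card :=
    Finset.card_erase_add_one (by simp [ha, haS])
  have e := leastValue_insert_update (S := R.base w ∪ (R.body w ∩ S)) (a := a) (by simp [hb, haS]) ρ x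
  rw [potential_eq, i1, i2, e, ← i3]
  push_cast
  simp

lemma exists_le_leastValue_of_isRecord (h : R.IsRecord (Function.update ρ a x) a) :
    ∃ w ∈ R.paths, a ∈ R.body w ∧ x ≤ leastValue (R.base w ∪ (R.body w ∩ S)) ρ := by
  obtain ⟨w, hw, ha, hr⟩ := h
  refine ⟨w, hw, ha, le_leastValue_iff.2 fun f hf => ?_⟩
  have hfa : f ≠ a := by
    rintro rfl
    rcases Finset.mem_union.1 hf with h | h
    · exact lt_irrefl _ (R.base_lt w hw _ h _ ha)
    · exact haS (Finset.mem_inter.1 h).2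
  have := hr f (by
    rcases Finset.mem_union.1 hf with h | h
    · exact Or.inl h
    · exact Or.inr (Finset.mem_inter.1 h).1) (by
    rcases Finset.mem_union.1 hf with h | h
    · exact R.base_lt w hw _ h _ ha
    · have h' := Finset.mem_inter.1 h
      -- Ranks may tie in the tree but not within one body, so a previously explored body element
      -- has strictly smaller rank.
      refine lt_of_le_of_ne (hS f h'.2) fun he => hfa (R.rank_injOn w hw h'.1 ha he))
  rwa [Function.update_self, Function.update_of_ne hfa] at this

/-- The supermartingale step. The new element yields at most one record, however many paths contain
it, so the potential of a single path can finance the factor 2. -/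
lemma lintegral_weight_update_le :
    ∫⁻ x, ENNReal.ofReal (R.weight (insert a S) (Function.update ρ a x)) ≤
      ENNReal.ofReal (R.weight S ρ) := by
  classical
  let th : ι → unitInterval := fun w => leastValue (R.base w ∪ (R.body w ∩ S)) ρ
  let P := R.paths.filter fun w => a ∈ R.body w
  have hpot : ∀ w, R.potential S ρ w = 1 + ((R.body w \ S).card : ℝ) * (th w : ℝ) :=
    fun w => R.potential_eq S ρ w
  by_cases hP : P.Nonempty
  -- The paying path is the one with the largest threshold: a record on any path through `a` forces
  -- `x` below this threshold.
  · obtain ⟨w₀, hw₀, hmax⟩ := P.exists_max_image th hP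
    obtain ⟨hw₀p, ha₀⟩ := Finset.mem_filter.1 hw₀
    have hcard : ∀ w, a ∈ R.body w → (1 : ℝ) ≤ (R.body w \ S).card := by
      intro w hw
      have : 0 < (R.body w \ S).card := Finset.card_pos.2 ⟨a, by simp [hw, haS]⟩
      exact_mod_cast this
    set C : ℝ := 2 ^ R.recordCount S ρ *
      ((∏ w ∈ R.paths.erase w₀, R.potential S ρ w / R.initial ρ w) / R.initial ρ w₀) with hC
    have hC0 : 0 ≤ C := by
      refine mul_nonneg (by positivity) (div_nonneg (Finset.prod_nonneg fun w _ => ?_)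
        (R.initial_pos _ _).le)
      exact (div_pos (R.potential_pos _ _ _) (R.initial_pos _ _)).le
    set b : ℝ := ((R.body w₀ \ S).card : ℝ) - 1 with hb
    have hb0 : 0 ≤ b := by have := hcard w₀ ha₀; linarith
    have hpt : ∀ x : unitInterval, R.weight (insert a S) (Function.update ρ a x) ≤
        C * ((if x ≤ th w₀ then 2 else 1) * (1 + b * min (x : ℝ) (th w₀))) := by
      intro x
      have h1 : (2 : ℝ) ^ R.recordCount (insert a S) (Function.update ρ a x) ≤
          2 ^ R.recordCount S ρ * (if x ≤ th w₀ then 2 else 1) := by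
        rw [recordCount_insert_update haS hS, pow_add]
        gcongr
        by_cases hr : R.IsRecord (Function.update ρ a x) a
        · obtain ⟨w, hw, haw, hx⟩ := exists_le_leastValue_of_isRecord haS hS ρ x hr
          have : x ≤ th w₀ := hx.trans (hmax w (Finset.mem_filter.2 ⟨hw, haw⟩))
          simp [hr, this]
        · simp only [hr, if_false, pow_zero]
          split_ifs <;> norm_num
      have h2 : ∏ w ∈ R.paths, R.potential (insert a S) (Function.update ρ a x) w /
            R.initial (Function.update ρ a x) w ≤
          (1 + b * min (x : ℝ) (th w₀)) *
          ((∏ w ∈ R.paths.erase w₀, R.potential S ρ w / R.initial ρ w) / R.initial ρ w₀) := by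
        rw [← Finset.mul_prod_erase _ _ hw₀p, potential_insert_update_of_mem haS hS ρ x hw₀p ha₀,
          initial_update_of_mem haS hS ρ x hw₀p ha₀]
        -- Other paths through `a` lose one unexplored element and their minimum cannot increase, so
        -- their potentials do not grow.
        have h3 : ∏ w ∈ R.paths.erase w₀, R.potential (insert a S) (Function.update ρ a x) w /
            R.initial (Function.update ρ a x) w ≤
            ∏ w ∈ R.paths.erase w₀, R.potential S ρ w / R.initial ρ w := by
          refine Finset.prod_le_prod (fun w _ =>
            (div_pos (R.potential_pos _ _ _) (R.initial_pos _ _)).le) fun w hw => ?_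
          have hwp := Finset.mem_of_mem_erase hw
          by_cases haw : a ∈ R.body w
          · rw [initial_update_of_mem haS hS ρ x hwp haw]
            refine div_le_div_of_nonneg_right ?_ (R.initial_pos _ _).le
            rw [potential_insert_update_of_mem haS hS ρ x hwp haw, hpot]
            have hc := hcard w haw
            have ht := (th w).2.1
            have : min (x : ℝ) (th w) ≤ th w := min_le_right _ _
            have : (((R.body w \ S).card : ℝ) - 1) * min (x : ℝ) (th w) ≤
                ((R.body w \ S).card : ℝ) * th w := by
              calc _ ≤ (((R.body w \ S).card : ℝ) - 1) * th w :=
                    mul_le_mul_of_nonneg_left this (by linarith)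
                _ ≤ _ := by nlinarith
            linarith
          · rw [potential_div_insert_update_of_notMem haS hS ρ x hwp haw]
        have hq : 0 ≤ (1 + b * min (x : ℝ) (th w₀)) / R.initial ρ w₀ := by
          refine div_nonneg ?_ (R.initial_pos _ _).le
          have := mul_nonneg hb0 (le_min x.2.1 (th w₀).2.1)
          linarith
        calc _ ≤ (1 + b * min (x : ℝ) (th w₀)) / R.initial ρ w₀ *
              ∏ w ∈ R.paths.erase w₀, R.potential S ρ w / R.initial ρ w :=
              mul_le_mul_of_nonneg_left h3 hq
          _ = _ := by ring
      unfold weight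
      calc _ ≤ (2 ^ R.recordCount S ρ * (if x ≤ th w₀ then 2 else 1)) *
          ((1 + b * min (x : ℝ) (th w₀)) *
          ((∏ w ∈ R.paths.erase w₀, R.potential S ρ w / R.initial ρ w) / R.initial ρ w₀)) := by
            refine mul_le_mul h1 h2 (Finset.prod_nonneg fun w _ =>
              (div_pos (R.potential_pos _ _ _) (R.initial_pos _ _)).le) ?_
            split_ifs <;> positivity
        _ = _ := by rw [hC]; ring
    calc _ ≤ ∫⁻ x : unitInterval, ENNReal.ofReal C *
          ENNReal.ofReal ((if x ≤ th w₀ then 2 else 1) * (1 + b * min (x : ℝ) (th w₀))) := by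
          refine lintegral_mono fun x => ?_
          rw [← ENNReal.ofReal_mul hC0]
          exact ENNReal.ofReal_le_ofReal (hpt x)
      _ = ENNReal.ofReal (C * (1 + (b + 1) * th w₀)) := by
          rw [lintegral_const_mul' _ _ ENNReal.ofReal_ne_top, lintegral_record_step _ hb0,
            ENNReal.ofReal_mul hC0]
      _ = _ := by
          congr 1
          unfold weight
          rw [← Finset.mul_prod_erase _ _ hw₀p, hpot w₀, hC, hb]
          ring
  · have hno : ∀ w ∈ R.paths, a ∉ R.body w := fun w hw haw =>
      hP ⟨w, Finset.mem_filter.2 ⟨hw, haw⟩⟩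
    have : ∀ x, R.weight (insert a S) (Function.update ρ a x) = R.weight S ρ := by
      intro x
      unfold weight
      rw [recordCount_insert_update haS hS, if_neg, add_zero]
      · congr 1
        exact Finset.prod_congr rfl fun w hw =>
          potential_div_insert_update_of_notMem haS hS ρ x hw (hno w hw)
      · rintro ⟨w, hw, haw, _⟩
        exact hno w hw haw
    simp [this]

end step

/-- Exploration follows increasing rank, so each added element has maximal rank among those already
explored. -/
lemma lintegral_weight_le_one [Fintype E] (S : Finset E) :
    ∫⁻ ρ, ENNReal.ofReal (R.weight S ρ) ∂(Measure.pi fun _ => volume) ≤ 1 := by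
  classical
  refine Finset.induction_on_max_value R.rank S ?_ ?_
  · have : ∀ ρ, R.weight ∅ ρ = 1 := by
      intro ρ
      unfold weight
      rw [Finset.prod_congr rfl fun w _ => by
        rw [R.potential_of_disjoint (Finset.disjoint_empty_right _), div_self (R.initial_pos _ _).ne']]
      simp [recordCount]
    simp [this]
  · intro a S haS hS ih
    refine le_trans (lintegral_pi_le_of_update (F := fun ρ => ENNReal.ofReal (R.weight S ρ)) a
      (R.measurable_weight _).ennreal_ofReal fun ρ => ?_) ih
    exact lintegral_weight_update_le haS hS ρ

end RecordSystem

/-! ### Exponential moments and independence -/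

lemma measure_le_leastValue {E : Type*} [Fintype E] (S : Finset E) (x : unitInterval) :
    (Measure.pi fun _ : E => (volume : Measure unitInterval)) {ρ | x ≤ leastValue S ρ} =
      ENNReal.ofReal ((1 - x) ^ S.card) := by
  classical
  have : {ρ : E → unitInterval | x ≤ leastValue S ρ} =
      Set.univ.pi fun e => if e ∈ S then Set.Ici x else Set.univ := by
    ext ρ
    simp only [Set.mem_ofPred_eq, le_leastValue_iff, Set.mem_univ_pi]
    refine forall_congr' fun e => ?_
    split_ifs with h <;> simp [h]
  rw [this, Measure.pi_pi]
  have h : ∀ e, (volume : Measure unitInterval) (if e ∈ S then Set.Ici x else Set.univ) =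
      if e ∈ S then ENNReal.ofReal (1 - x) else 1 := by
    intro e; split_ifs <;> simp
  simp only [h]
  rw [Finset.prod_ite, Finset.prod_const_one, mul_one, Finset.prod_const,
    ENNReal.ofReal_pow (by have := x.2.2; linarith)]
  congr 2
  ext; simp

/-- The exponential moment of a rescaled minimum of uniform values. -/
lemma lintegral_exp_leastValue_le {E : Type*} [Fintype E] (S : Finset E) {s : ℝ} (hs : 0 ≤ s)
    (hsS : 2 * s ≤ S.card) :
    ∫⁻ ρ, ENNReal.ofReal (Real.exp (s * leastValue S ρ)) ∂(Measure.pi fun _ => volume) ≤ 2 := by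
  have hmeas := measurable_leastValue S
  have h0 : ∀ ρ, 0 ≤ s * (leastValue S ρ : ℝ) := fun ρ => mul_nonneg hs (leastValue S ρ).2.1
  have tail : ∀ t > 0, (Measure.pi fun _ : E => (volume : Measure unitInterval))
      {ρ | t ≤ s * leastValue S ρ} ≤ ENNReal.ofReal (Real.exp (-2 * t)) := by
    intro t ht
    rcases hs.eq_or_lt with rfl | hs
    · have : {ρ : E → unitInterval | t ≤ 0 * (leastValue S ρ : ℝ)} = ∅ := by
        ext ρ; simp [ht]
      rw [this]; simp
    by_cases hts : t / s ≤ 1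
    · have hx0 : 0 ≤ t / s := by positivity
      have : {ρ : E → unitInterval | t ≤ s * leastValue S ρ} =
          {ρ | (⟨t / s, hx0, hts⟩ : unitInterval) ≤ leastValue S ρ} := by
        ext ρ
        simp only [Set.mem_ofPred_eq, ← Subtype.coe_le_coe]
        rw [div_le_iff₀ hs, mul_comm]
      rw [this, measure_le_leastValue]
      refine ENNReal.ofReal_le_ofReal ?_
      have h1 : 1 - t / s ≤ Real.exp (-(t / s)) := by
        have := Real.add_one_le_exp (-(t / s)); linarith
      calc (1 - t / s) ^ S.card ≤ Real.exp (-(t / s)) ^ S.card :=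
            pow_le_pow_left₀ (by linarith) h1 _
        _ = Real.exp (-(S.card * (t / s))) := by
            rw [← Real.exp_nat_mul]; congr 1; ring
        _ ≤ _ := by
            refine Real.exp_le_exp.2 ?_
            have : 2 * s * (t / s) ≤ S.card * (t / s) := mul_le_mul_of_nonneg_right hsS hx0
            have e : 2 * s * (t / s) = 2 * t := by field_simp
            linarith
    · have : {ρ : E → unitInterval | t ≤ s * leastValue S ρ} = ∅ := by
        ext ρ
        simp only [Set.mem_ofPred_eq, Set.mem_empty_iff_false, iff_false, not_le]
        rw [not_le, one_lt_div hs] at hts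
        have := (leastValue S ρ).2.2
        nlinarith
      rw [this]; simp
  have e1 : ∀ ρ : E → unitInterval, ENNReal.ofReal (Real.exp (s * leastValue S ρ)) =
      1 + ENNReal.ofReal (∫ t in (0:ℝ)..(s * leastValue S ρ), Real.exp t) := by
    intro ρ
    rw [integral_exp, Real.exp_zero, ← ENNReal.ofReal_one, ← ENNReal.ofReal_add zero_le_one]
    · congr 1; ring
    · have := Real.one_le_exp (h0 ρ); linarith
  simp only [e1]
  rw [lintegral_add_left measurable_const, lintegral_comp_eq_lintegral_meas_le_mul]
  · have : ∫⁻ t in Set.Ioi (0:ℝ), (Measure.pi fun _ : E => (volume : Measure unitInterval))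
        {ρ | t ≤ s * leastValue S ρ} * ENNReal.ofReal (Real.exp t) ≤
        ∫⁻ t in Set.Ioi (0:ℝ), ENNReal.ofReal (Real.exp (-t)) := by
      refine setLIntegral_mono (by fun_prop) fun t ht => ?_
      calc _ ≤ ENNReal.ofReal (Real.exp (-2 * t)) * ENNReal.ofReal (Real.exp t) := by
            gcongr; exact tail t ht
        _ = _ := by
            rw [← ENNReal.ofReal_mul (Real.exp_pos _).le, ← Real.exp_add]; congr 2; ring
    have e2 : ∫⁻ t in Set.Ioi (0:ℝ), ENNReal.ofReal (Real.exp (-t)) = 1 := by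
      rw [← ofReal_integral_eq_lintegral_ofReal, integral_exp_neg_Ioi_zero, ENNReal.ofReal_one]
      · exact integrableOn_exp_neg_Ioi 0
      · exact Filter.Eventually.of_forall fun t => (Real.exp_pos _).le
    rw [e2] at this
    calc _ ≤ (1 : ENNReal) + 1 := by
          gcongr
          simp
      _ = 2 := by norm_num
  · exact Filter.Eventually.of_forall h0
  · fun_prop
  · intro t _
    exact Real.continuous_exp.intervalIntegrable _ _
  · exact Filter.Eventually.of_forall fun t => (Real.exp_pos _).le

/-- Products of functions of disjoint sets of coordinates. -/
lemma lintegral_prod_of_disjoint_le {E κ : Type*} [Fintype E] (I : Finset κ) (U : κ → Finset E)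
    (hU : Set.PairwiseDisjoint (I : Set κ) U) (f : κ → (E → unitInterval) → ENNReal)
    (hf : ∀ i ∈ I, Measurable (f i)) (hfU : ∀ i ∈ I, DependsOn (f i) (U i)) {c : ENNReal}
    (hc : ∀ i ∈ I, ∫⁻ ρ, f i ρ ∂(Measure.pi fun _ => volume) ≤ c) :
    ∫⁻ ρ, ∏ i ∈ I, f i ρ ∂(Measure.pi fun _ => volume) ≤ c ^ I.card := by
  classical
  -- A function depending only on `V` factors through restriction to `V`; the filler value 0 outside
  -- `V` is immaterial.
  have factor : ∀ (V : Finset E) (g : (E → unitInterval) → ENNReal), Measurable g → DependsOn g V →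
      ∃ g' : (V → unitInterval) → ENNReal, Measurable g' ∧ g = g' ∘ fun ρ (i : V) => ρ i := by
    intro V g hg hgV
    refine ⟨fun y => g fun e => if h : e ∈ V then y ⟨e, h⟩ else 0, hg.comp ?_, ?_⟩
    · refine measurable_pi_lambda _ fun e => ?_
      split_ifs with h
      · exact measurable_pi_apply _
      · exact measurable_const
    · funext ρ
      refine hgV fun e he => ?_
      have : e ∈ V := he
      simp [this]
  induction I using Finset.induction_on with
  | empty => simp
  | insert i I hi ih =>
    simp only [Finset.mem_insert, forall_eq_or_imp] at hf hfU hc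
    have hU' : Set.PairwiseDisjoint (I : Set κ) U := hU.subset (by simp)
    obtain ⟨g, hg, hge⟩ := factor (U i) (f i) hf.1 hfU.1
    have hPm : Measurable fun ρ => ∏ j ∈ I, f j ρ := Finset.measurable_prod _ fun j hj => hf.2 j hj
    have hPd : DependsOn (fun ρ => ∏ j ∈ I, f j ρ) (I.biUnion U : Finset E) := by
      intro x y hxy
      refine Finset.prod_congr rfl fun j hj => hfU.2 j hj fun e he => hxy e ?_
      exact Finset.mem_coe.2 (Finset.mem_biUnion.2 ⟨j, hj, he⟩)
    obtain ⟨g', hg', hge'⟩ := factor (I.biUnion U) _ hPm hPd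
    have hdisj : Disjoint (U i) (I.biUnion U) := by
      rw [Finset.disjoint_biUnion_right]
      intro j hj
      exact hU (by simp) (by simp [hj]) (by rintro rfl; exact hi hj)
    have hind := ProbabilityTheory.iIndepFun.indepFun_finset (U i) (I.biUnion U) hdisj
      (ProbabilityTheory.iIndepFun_pi (μ := fun _ : E => (volume : Measure unitInterval))
        (X := fun _ x => x) fun _ => aemeasurable_id) fun e => measurable_pi_apply e
    have hind2 := hind.comp hg hg'
    have := ProbabilityTheory.lintegral_mul_eq_lintegral_mul_lintegral_of_indepFun hf.1 hPm
      (by rw [hge, hge']; exact hind2)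
    simp only [Finset.prod_insert hi, Finset.card_insert_of_notMem hi]
    simp only [Pi.mul_apply] at this
    rw [this, pow_succ, mul_comm]
    exact mul_le_mul' (ih hU' hf.2 hfU.2 hc.2) hc.1

/-! ### Concentration for layered record systems -/

namespace RecordSystem

variable {E κ ι : Type*} (R : RecordSystem E (Σ _ : κ, ι)) (K : κ → Finset ι)

/-- The average over the paths of the layer `i` of the rescaled least value on the base. -/
noncomputable def layerMean (i : κ) (ρ : E → unitInterval) : ℝ :=
  (∑ w ∈ K i, (R.body ⟨i, w⟩).card * (leastValue (R.base ⟨i, w⟩) ρ : ℝ)) / (K i).card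

lemma layerMean_nonneg (i : κ) (ρ : E → unitInterval) : 0 ≤ R.layerMean K i ρ :=
  div_nonneg (Finset.sum_nonneg fun _ _ => mul_nonneg (Nat.cast_nonneg _) (leastValue _ _).2.1)
    (Nat.cast_nonneg _)

lemma measurable_layerMean (i : κ) : Measurable (R.layerMean K i) := by
  unfold layerMean
  refine Measurable.div_const (Finset.measurable_sum _ fun w _ => ?_) _
  have := measurable_leastValue (R.base ⟨i, w⟩)
  fun_prop

/-- Jensen's inequality for the exponential reduces the average to single paths, whose bases need
not be disjoint. With `s = |body| / 8`, the length condition `|body| ≤ 4 |base|` is exactly `2 s ≤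
|base|`. -/
lemma lintegral_exp_layerMean_le [Fintype E] (i : κ)
    (hcard : ∀ w ∈ K i, (R.body ⟨i, w⟩).card ≤ 4 * (R.base ⟨i, w⟩).card) :
    ∫⁻ ρ, ENNReal.ofReal (Real.exp (R.layerMean K i ρ / 8)) ∂(Measure.pi fun _ => volume) ≤ 2 := by
  rcases (K i).eq_empty_or_nonempty with h | h
  · simp [layerMean, h]
  have hk : (0 : ℝ) < (K i).card := by exact_mod_cast Finset.card_pos.2 h
  have jensen : ∀ ρ : E → unitInterval, Real.exp (R.layerMean K i ρ / 8) ≤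
      ∑ w ∈ K i, ((K i).card : ℝ)⁻¹ *
        Real.exp (((R.body ⟨i, w⟩).card / 8 : ℝ) * leastValue (R.base ⟨i, w⟩) ρ) := by
    intro ρ
    have := convexOn_exp.map_sum_le (t := K i) (w := fun _ => ((K i).card : ℝ)⁻¹)
      (p := fun w => ((R.body ⟨i, w⟩).card / 8 : ℝ) * leastValue (R.base ⟨i, w⟩) ρ)
      (fun _ _ => by positivity) (by simp [hk.ne']) (fun _ _ => Set.mem_univ _)
    simp only [smul_eq_mul] at this
    have e : ∑ w ∈ K i, ((K i).card : ℝ)⁻¹ *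
        ((R.body ⟨i, w⟩).card / 8 * (leastValue (R.base ⟨i, w⟩) ρ : ℝ)) =
        R.layerMean K i ρ / 8 := by
      unfold layerMean
      rw [Finset.sum_div, Finset.sum_div]
      refine Finset.sum_congr rfl fun w _ => ?_
      field_simp
    rw [e] at this
    exact this
  calc _ ≤ ∫⁻ ρ, ∑ w ∈ K i, ENNReal.ofReal ((K i).card : ℝ)⁻¹ * ENNReal.ofReal
        (Real.exp (((R.body ⟨i, w⟩).card / 8 : ℝ) * leastValue (R.base ⟨i, w⟩) ρ))
        ∂(Measure.pi fun _ => volume) := by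
        refine lintegral_mono fun ρ => ?_
        refine (ENNReal.ofReal_le_ofReal (jensen ρ)).trans ?_
        rw [ENNReal.ofReal_sum_of_nonneg fun _ _ => by positivity]
        refine Finset.sum_le_sum fun w _ => ?_
        rw [ENNReal.ofReal_mul (by positivity)]
    _ = ∑ w ∈ K i, ENNReal.ofReal ((K i).card : ℝ)⁻¹ * ∫⁻ ρ, ENNReal.ofReal
        (Real.exp (((R.body ⟨i, w⟩).card / 8 : ℝ) * leastValue (R.base ⟨i, w⟩) ρ))
        ∂(Measure.pi fun _ => volume) := by
        have hm : ∀ w ∈ K i, Measurable fun ρ : E → unitInterval => ENNReal.ofReal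
            (Real.exp (((R.body ⟨i, w⟩).card / 8 : ℝ) * leastValue (R.base ⟨i, w⟩) ρ)) := by
          intro w _
          have := measurable_leastValue (R.base ⟨i, w⟩)
          fun_prop
        rw [lintegral_finsetSum _ fun w hw => (hm w hw).const_mul _]
        exact Finset.sum_congr rfl fun w hw => lintegral_const_mul _ (hm w hw)
    _ ≤ ∑ w ∈ K i, ENNReal.ofReal ((K i).card : ℝ)⁻¹ * 2 := by
        refine Finset.sum_le_sum fun w hw => ?_
        gcongr
        refine lintegral_exp_leastValue_le _ (by positivity) ?_
        have : ((R.body ⟨i, w⟩).card : ℝ) ≤ 4 * (R.base ⟨i, w⟩).card := by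
          exact_mod_cast hcard w hw
        linarith
    _ = 2 := by
        rw [Finset.sum_const, nsmul_eq_mul, ← mul_assoc, ← ENNReal.ofReal_natCast,
          ← ENNReal.ofReal_mul hk.le, mul_inv_cancel₀ hk.ne', ENNReal.ofReal_one, one_mul]

lemma dependsOn_layerMean [DecidableEq E] (i : κ) :
    DependsOn (R.layerMean K i) ((K i).biUnion fun w => R.base ⟨i, w⟩ : Finset E) := by
  intro x y hxy
  unfold layerMean
  congr 1
  refine Finset.sum_congr rfl fun w hw => ?_
  rw [leastValue_congr fun f hf => hxy f (Finset.mem_coe.2 (Finset.mem_biUnion.2 ⟨w, hw, hf⟩))]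

variable {K} {I : Finset κ}

/-- Chernoff bound: by independence of the layers the moment is at most `2 ^ |I|`, and the term `8
|I|` in the threshold supplies `e ^ |I|` to absorb it. -/
lemma measure_sum_layerMean_ge_le [Fintype E] {n : ℝ} (hn : 0 < n)
    (hcard : ∀ i ∈ I, ∀ w ∈ K i, (R.body ⟨i, w⟩).card ≤ 4 * (R.base ⟨i, w⟩).card)
    (hdisj : ∀ i ∈ I, ∀ j ∈ I, i ≠ j → ∀ w ∈ K i, ∀ w' ∈ K j,
      Disjoint (R.base ⟨i, w⟩) (R.base ⟨j, w'⟩)) :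
    (Measure.pi fun _ : E => (volume : Measure unitInterval))
      {ρ | 16 * Real.log n + 8 * I.card ≤ ∑ i ∈ I, R.layerMean K i ρ} ≤
        ENNReal.ofReal (1 / n ^ 2) := by
  classical
  have hmom : ∫⁻ ρ, ENNReal.ofReal (Real.exp ((∑ i ∈ I, R.layerMean K i ρ) / 8))
      ∂(Measure.pi fun _ : E => (volume : Measure unitInterval)) ≤ 2 ^ I.card := by
    have := lintegral_prod_of_disjoint_le I (fun i => (K i).biUnion fun w => R.base ⟨i, w⟩)
      (by
        intro i hi j hj hij
        simp only [Function.onFun]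
        rw [Finset.disjoint_biUnion_left]
        intro w hw
        rw [Finset.disjoint_biUnion_right]
        exact fun w' hw' => hdisj i hi j hj hij w hw w' hw')
      (fun i ρ => ENNReal.ofReal (Real.exp (R.layerMean K i ρ / 8)))
      (fun i _ => by have := R.measurable_layerMean K i; fun_prop)
      (fun i _ x y hxy => by
        have := R.dependsOn_layerMean K i hxy
        simp only [this])
      (fun i hi => R.lintegral_exp_layerMean_le K i (hcard i hi))
    refine le_trans (le_of_eq (lintegral_congr fun ρ => ?_)) this
    rw [← ENNReal.ofReal_prod_of_nonneg fun _ _ => (Real.exp_pos _).le, ← Real.exp_sum,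
      Finset.sum_div]
  set ε : ℝ := Real.exp (2 * Real.log n + I.card) with hε
  have hsub : {ρ : E → unitInterval | 16 * Real.log n + 8 * I.card ≤
      ∑ i ∈ I, R.layerMean K i ρ} ⊆
      {ρ | ENNReal.ofReal ε ≤
        ENNReal.ofReal (Real.exp ((∑ i ∈ I, R.layerMean K i ρ) / 8))} := by
    intro ρ hρ
    refine ENNReal.ofReal_le_ofReal (Real.exp_le_exp.2 ?_)
    simp only [Set.mem_ofPred_eq] at hρ
    linarith
  refine (measure_mono hsub).trans ?_
  have hεpos : 0 < ε := Real.exp_pos _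
  have hm : Measurable fun ρ : E → unitInterval =>
      ENNReal.ofReal (Real.exp ((∑ i ∈ I, R.layerMean K i ρ) / 8)) := by
    have := Finset.measurable_sum I fun i _ => R.measurable_layerMean K i
    fun_prop
  refine (meas_ge_le_lintegral_div hm.aemeasurable
    (ENNReal.ofReal_pos.2 hεpos).ne' ENNReal.ofReal_ne_top).trans ?_
  refine (ENNReal.div_le_div_right hmom _).trans ?_
  have h2 : (2 : ENNReal) ^ I.card = ENNReal.ofReal (2 ^ I.card) := by
    rw [ENNReal.ofReal_pow (by norm_num)]; norm_num
  rw [h2, ← ENNReal.ofReal_div_of_pos hεpos]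
  refine ENNReal.ofReal_le_ofReal ?_
  rw [div_le_div_iff₀ hεpos (by positivity), one_mul, hε, Real.exp_add, mul_comm 2 (Real.log n),
    Real.exp_mul, Real.exp_log hn, Real.rpow_two, mul_comm]
  refine mul_le_mul_of_nonneg_left ?_ (by positivity)
  have : Real.exp (I.card : ℝ) = Real.exp 1 ^ I.card := by rw [← Real.exp_nat_mul, mul_one]
  rw [this]
  refine pow_le_pow_left₀ (by norm_num) ?_ _
  have := Real.add_one_le_exp (1 : ℝ)
  linarith

lemma measure_weight_ge_le [Fintype E] {n : ℝ} (hn : 0 < n) :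
    (Measure.pi fun _ : E => (volume : Measure unitInterval))
      {ρ | n ^ 2 ≤ R.weight Finset.univ ρ} ≤ ENNReal.ofReal (1 / n ^ 2) := by
  have hsub : {ρ : E → unitInterval | n ^ 2 ≤ R.weight Finset.univ ρ} ⊆
      {ρ | ENNReal.ofReal (n ^ 2) ≤ ENNReal.ofReal (R.weight Finset.univ ρ)} :=
    fun ρ hρ => ENNReal.ofReal_le_ofReal hρ
  have hn2 : 0 < n ^ 2 := by positivity
  refine (measure_mono hsub).trans ((meas_ge_le_lintegral_div
    (R.measurable_weight _).ennreal_ofReal.aemeasurable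
    (ENNReal.ofReal_pos.2 hn2).ne' ENNReal.ofReal_ne_top).trans ?_)
  refine (ENNReal.div_le_div_right (R.lintegral_weight_le_one _) _).trans ?_
  rw [ENNReal.ofReal_div_of_pos hn2, ENNReal.ofReal_one]

/-- After full exploration every potential equals 1, so `weight` is `2 ^ records` divided by the
product of initial potentials. Take logarithms and apply Jensen's inequality within each layer. -/
lemma recordCount_mul_log_two_le [Fintype E] (hR : R.paths = I.sigma K) {n : ℝ} (hn : 0 < n)
    {ρ : E → unitInterval} (h : R.weight Finset.univ ρ < n ^ 2) :
    R.recordCount Finset.univ ρ * Real.log 2 ≤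
      2 * Real.log n + ∑ i ∈ I, (K i).card * Real.log (1 + R.layerMean K i ρ) := by
  have hprod : 0 < ∏ w ∈ R.paths, R.initial ρ w := Finset.prod_pos fun w _ => R.initial_pos ρ w
  have h1 : (2 : ℝ) ^ R.recordCount Finset.univ ρ ≤ n ^ 2 * ∏ w ∈ R.paths, R.initial ρ w := by
    unfold weight at h
    simp only [potential_univ, one_div, Finset.prod_inv_distrib] at h
    rw [← div_eq_mul_inv, div_lt_iff₀ hprod] at h
    exact h.le
  have h2 := Real.log_le_log (by positivity) h1
  rw [Real.log_pow, Real.log_mul (by positivity) hprod.ne', Real.log_pow,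
    Real.log_prod fun w _ => (R.initial_pos ρ w).ne', hR, Finset.sum_sigma] at h2
  refine h2.trans ?_
  push_cast
  gcongr with i hi
  rcases (K i).eq_empty_or_nonempty with he | he
  · simp [he]
  have hk : (0 : ℝ) < (K i).card := by exact_mod_cast Finset.card_pos.2 he
  have := strictConcaveOn_log_Ioi.concaveOn.le_map_sum (t := K i)
    (w := fun _ => ((K i).card : ℝ)⁻¹) (p := fun w => R.initial ρ ⟨i, w⟩)
    (fun _ _ => by positivity) (by simp [hk.ne']) (fun w _ => R.initial_pos ρ _)
  simp only [smul_eq_mul, ← Finset.mul_sum] at this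
  have e : ((K i).card : ℝ)⁻¹ * ∑ w ∈ K i, R.initial ρ ⟨i, w⟩ = 1 + R.layerMean K i ρ := by
    unfold initial layerMean
    rw [Finset.sum_add_distrib]
    simp only [Finset.sum_const, nsmul_eq_mul, mul_one]
    field_simp
  rw [e, inv_mul_le_iff₀ hk] at this
  exact this

/-- With high probability there are few records. -/
lemma measure_records_bad_le [Fintype E] (hR : R.paths = I.sigma K) {n : ℝ} (hn : 0 < n)
    (hcard : ∀ i ∈ I, ∀ w ∈ K i, (R.body ⟨i, w⟩).card ≤ 4 * (R.base ⟨i, w⟩).card)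
    (hdisj : ∀ i ∈ I, ∀ j ∈ I, i ≠ j → ∀ w ∈ K i, ∀ w' ∈ K j,
      Disjoint (R.base ⟨i, w⟩) (R.base ⟨j, w'⟩)) :
    (Measure.pi fun _ : E => (volume : Measure unitInterval))
      {ρ | ¬ (R.recordCount Finset.univ ρ * Real.log 2 ≤
          2 * Real.log n + ∑ i ∈ I, (K i).card * Real.log (1 + R.layerMean K i ρ) ∧
        ∑ i ∈ I, R.layerMean K i ρ < 16 * Real.log n + 8 * I.card)} ≤
      ENNReal.ofReal (2 / n ^ 2) := by
  have hsub : {ρ : E → unitInterval | ¬ (R.recordCount Finset.univ ρ * Real.log 2 ≤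
          2 * Real.log n + ∑ i ∈ I, (K i).card * Real.log (1 + R.layerMean K i ρ) ∧
        ∑ i ∈ I, R.layerMean K i ρ < 16 * Real.log n + 8 * I.card)} ⊆
      {ρ | n ^ 2 ≤ R.weight Finset.univ ρ} ∪
      {ρ | 16 * Real.log n + 8 * I.card ≤ ∑ i ∈ I, R.layerMean K i ρ} := by
    intro ρ hρ
    by_contra hc
    simp only [Set.mem_union, Set.mem_ofPred_eq, not_or, not_le] at hc
    exact hρ ⟨R.recordCount_mul_log_two_le hR hn hc.1, hc.2⟩
  refine (measure_mono hsub).trans ((measure_union_le _ _).trans ?_)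
  refine (add_le_add (R.measure_weight_ge_le hn)
    (R.measure_sum_layerMean_ge_le hn hcard hdisj)).trans ?_
  rw [← ENNReal.ofReal_add (by positivity) (by positivity)]
  refine ENNReal.ofReal_le_ofReal (le_of_eq (by ring))

end RecordSystem

/-! ### Arithmetic of the layer radii -/

lemma layerRadius_strictMono : StrictMono layerRadius := by
  refine strictMono_nat_of_lt_succ fun i => ?_
  unfold layerRadius
  rw [Nat.lt_ceil]
  have h1 : (1 : ℝ) ≤ (16 / 15 : ℝ) ^ i := one_le_pow₀ (by norm_num)
  have h2 := Nat.ceil_lt_add_one (a := 15 * (16 / 15 : ℝ) ^ i) (by positivity)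
  rw [pow_succ]
  linarith

lemma le_layerRadius (i : ℕ) : 15 * (16 / 15 : ℝ) ^ i ≤ layerRadius i := Nat.le_ceil _

lemma layerRadius_lt (i : ℕ) : (layerRadius i : ℝ) < 15 * (16 / 15 : ℝ) ^ i + 1 :=
  Nat.ceil_lt_add_one (by positivity)

/-- Without rounding, consecutive widths have ratio `16/15`; the factor 4 leaves room for the
ceilings when layers are only a few edges wide. -/
lemma layerRadius_width_le (i : ℕ) :
    layerRadius (i + 2) - layerRadius (i + 1) ≤ 4 * (layerRadius (i + 1) - layerRadius i) ∧
    layerRadius (i + 1) - layerRadius i ≤ 4 * (layerRadius (i + 2) - layerRadius (i + 1)) := by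
  have m0 := layerRadius_strictMono (Nat.lt_succ_self i)
  have m1 := layerRadius_strictMono (Nat.lt_succ_self (i + 1))
  have a0 := le_layerRadius i
  have a1 := le_layerRadius (i + 1)
  have a2 := le_layerRadius (i + 2)
  have b0 := layerRadius_lt i
  have b1 := layerRadius_lt (i + 1)
  have b2 := layerRadius_lt (i + 2)
  simp only [pow_succ, Nat.succ_eq_add_one] at *
  have h1 : (1 : ℝ) ≤ (16 / 15 : ℝ) ^ i := one_le_pow₀ (by norm_num)
  set c := (16 / 15 : ℝ) ^ i
  obtain ⟨p, hp⟩ := Nat.exists_eq_add_of_lt m0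
  obtain ⟨q, hq⟩ := Nat.exists_eq_add_of_lt m1
  have hp' : (layerRadius (i + 1) : ℝ) = layerRadius i + p + 1 := by exact_mod_cast hp
  have hq' : (layerRadius (i + 1 + 1) : ℝ) = layerRadius (i + 1) + q + 1 := by exact_mod_cast hq
  have k1 : (q : ℝ) < 4 * p + 4 := by
    have : (0 : ℝ) ≤ p := Nat.cast_nonneg p
    by_cases hc : c < 2 <;> linarith
  have k2 : (p : ℝ) < 4 * q + 4 := by
    have : (0 : ℝ) ≤ q := Nat.cast_nonneg q
    by_cases hc : c < 2 <;> linarith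
  have k1' : q < 4 * p + 4 := by exact_mod_cast k1
  have k2' : p < 4 * q + 4 := by exact_mod_cast k2
  simp only [show i + 2 = i + 1 + 1 from rfl]
  omega

lemma layerRadius_three : layerRadius 3 = 19 := by
  unfold layerRadius
  rw [Nat.ceil_eq_iff (by norm_num)]
  norm_num

lemma exists_layer {r : ℕ} (hr : 20 ≤ r) :
    ∃ j, 3 ≤ j ∧ layerRadius j < r ∧ r ≤ layerRadius (j + 1) := by
  classical
  have hex : ∃ k, r ≤ layerRadius k := ⟨r, layerRadius_strictMono.id_le r⟩
  have hspec := Nat.find_spec hex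
  have h4 : 4 ≤ Nat.find hex := by
    by_contra hlt
    have := layerRadius_strictMono.monotone (show Nat.find hex ≤ 3 by omega)
    rw [layerRadius_three] at this
    omega
  refine ⟨Nat.find hex - 1, by omega, ?_, ?_⟩
  · exact not_le.1 (Nat.find_min hex (m := Nat.find hex - 1) (by omega))
  · rwa [Nat.sub_add_cancel (by omega)]

/-- The layers around a depth `r` in the farther half of the central part of a path of length
`d`. -/
lemma layer_below {j r d : ℕ} (hr : 20 ≤ r) (h1 : layerRadius j < r)
    (hd : 12 * r ≤ 7 * d) (h5 : d ≤ 2 * r) (h2 : r ≤ layerRadius (j + 1)) (hj : 1 ≤ j) :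
    5 * d ≤ 12 * layerRadius (j - 1) ∧ 3 * layerRadius (j + 2) ≤ 2 * d := by
  obtain ⟨i, rfl⟩ : ∃ i, j = i + 1 := ⟨j - 1, by omega⟩
  have a0 := le_layerRadius i
  have a1 := le_layerRadius (i + 1)
  have b2 := layerRadius_lt (i + 1 + 1)
  have b3 := layerRadius_lt (i + 1 + 2)
  simp only [pow_succ, Nat.add_sub_cancel] at *
  set c := (16 / 15 : ℝ) ^ i
  have h1' : (layerRadius (i + 1) : ℝ) + 1 ≤ r := by exact_mod_cast h1
  have h2' : (r : ℝ) ≤ layerRadius (i + 1 + 1) := by exact_mod_cast h2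
  have hd' : (12 : ℝ) * r ≤ 7 * d := by exact_mod_cast hd
  have h5' : (d : ℝ) ≤ 2 * r := by exact_mod_cast h5
  have hr' : (20 : ℝ) ≤ r := by exact_mod_cast hr
  constructor
  -- Going back two layers costs a factor `225/256`, and `12 (225/256) (r - 1) ≥ 10 r` holds for
  -- integers exactly from `r = 20` on.
  · have : (5 : ℝ) * d ≤ 12 * layerRadius i := by linarith
    exact_mod_cast this
  -- The margin is thin: `(7/12) (16/15)² ≈ 0.664 < 2/3`. The strict inequality `layerRadius j < r`
  -- absorbs the rounding.
  · have : (3 : ℝ) * layerRadius (i + 1 + 2) ≤ 2 * d := by linarith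
    exact_mod_cast this

/-- The layers around a depth `r` in the nearer half of the central part of a path of length
`d`. -/
lemma layer_above {j r d : ℕ} (h1 : layerRadius j < r) (h5 : 2 * r ≤ d) :
    12 * layerRadius (j + 2) ≤ 7 * d ∧ 3 * layerRadius (j + 3) ≤ 2 * d := by
  have a1 := le_layerRadius j
  have b2 := layerRadius_lt (j + 2)
  have b3 := layerRadius_lt (j + 3)
  simp only [pow_succ] at *
  have h1c : (1 : ℝ) ≤ (16 / 15 : ℝ) ^ j := one_le_pow₀ (by norm_num)
  set c := (16 / 15 : ℝ) ^ j
  have h1' : (layerRadius j : ℝ) + 1 ≤ r := by exact_mod_cast h1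
  have h5' : (2 : ℝ) * r ≤ d := by exact_mod_cast h5
  constructor
  · have : (12 : ℝ) * layerRadius (j + 2) ≤ 7 * d := by linarith
    exact_mod_cast this
  · have : (3 : ℝ) * layerRadius (j + 3) ≤ 2 * d := by linarith
    exact_mod_cast this

/-- From `15 (16/15)^j ≤ D` and `ln (16/15) ≥ 1/16` one gets `j ≤ 16 ln D`; the factor 15 provides
the extra 1. -/
lemma mem_layerIndices {j r D : ℕ} (h1 : layerRadius j < r) (hD : 12 * r ≤ 7 * D) :
    j + 1 ≤ ⌊16 * Real.log D⌋₊ := by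
  have a1 := le_layerRadius j
  have h1' : (layerRadius j : ℝ) < r := by exact_mod_cast h1
  have hD' : (12 : ℝ) * r ≤ 7 * D := by exact_mod_cast hD
  have h1c : (0 : ℝ) < (16 / 15 : ℝ) ^ j := by positivity
  have hc : (16 / 15 : ℝ) ^ j * 15 ≤ D := by linarith
  have hl := Real.log_le_log (by positivity) hc
  rw [Real.log_mul (by positivity) (by norm_num), Real.log_pow] at hl
  have h16 : (1 / 16 : ℝ) ≤ Real.log (16 / 15) := by
    have := Real.one_sub_inv_le_log_of_pos (show (0 : ℝ) < 16 / 15 by norm_num)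
    norm_num at this ⊢; linarith
  have h15 : (1 / 16 : ℝ) ≤ Real.log 15 := by
    have := Real.one_sub_inv_le_log_of_pos (show (0 : ℝ) < 15 by norm_num)
    norm_num at this ⊢; linarith
  refine Nat.le_floor ?_
  push_cast
  have := mul_le_mul_of_nonneg_left h16 (Nat.cast_nonneg (α := ℝ) j)
  linarith

/-! ### Paths and edge depths in a rooted tree -/

section tree

variable {W : Type*} {G : SimpleGraph W} {T : G.Subgraph} {u v w : W}

lemma mem_verts_of_mem_support (hu : u ∈ T.verts) (p : T.spanningCoe.Walk u v) {x : W}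
    (hx : x ∈ p.support) : x ∈ T.verts := by
  induction p with
  | nil => simp only [SimpleGraph.Walk.support_nil, List.mem_singleton] at hx; rwa [hx]
  | cons h p ih =>
    rw [SimpleGraph.Walk.support_cons, List.mem_cons] at hx
    rcases hx with rfl | hx
    · exact hu
    · exact ih (T.edge_vert (SimpleGraph.Subgraph.spanningCoe_adj .. ▸ h).symm) hx

/-- Vertices outside the tree are isolated in `spanningCoe`, so a cycle there lies in the tree
itself. -/
lemma isAcyclic_spanningCoe (hT : T.coe.IsAcyclic) : T.spanningCoe.IsAcyclic := by
  intro x c hc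
  have hx : x ∈ T.verts := by
    cases c with
    | nil => exact absurd hc SimpleGraph.Walk.not_isCycle_nil
    | cons h p => exact T.edge_vert h
  have hs : ∀ y ∈ c.support, y ∈ T.verts := fun y hy => mem_verts_of_mem_support hx c hy
  have hmap := SimpleGraph.Walk.map_induce c hs
  have hc' : (c.induce T.verts hs).IsCycle := by
    rw [← SimpleGraph.Walk.isCycle_map_iff_of_injective
      (f := (SimpleGraph.Embedding.induce T.verts).toHom) Subtype.val_injective]
    rw [hmap]; exact hc
  exact hT _ hc'

lemma exists_isPath (hT : T.coe.Connected) (hu : u ∈ T.verts) (hv : v ∈ T.verts) :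
    ∃ p : T.spanningCoe.Walk u v, p.IsPath := by
  obtain ⟨q⟩ := hT.preconnected ⟨u, hu⟩ ⟨v, hv⟩
  have : T.spanningCoe.Reachable u v := ⟨q.map T.coeEmbeddingSpanningCoe.toHom⟩
  obtain ⟨p, hp, _⟩ := this.exists_path_of_dist
  exact ⟨p, hp⟩

variable (hT : T.spanningCoe.IsAcyclic) {p : T.spanningCoe.Walk u v} (hp : p.IsPath)

/-- The depth of an edge in the tree `T` rooted at `u`: the distance of its lower endpoint from the
root. -/
noncomputable def edgeDepth (T : G.Subgraph) (u : W) (e : Sym2 W) : ℕ :=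
  Sym2.lift ⟨fun x y => max (treeDist T u x) (treeDist T u y), fun _ _ => max_comm _ _⟩ e

include hT hp

lemma length_eq_treeDist : p.length = treeDist T u v := by
  obtain ⟨q, hq, hl⟩ := p.reachable.exists_path_of_dist
  have : p = q := congrArg Subtype.val ((hT.subsingleton_path u v).elim ⟨p, hp⟩ ⟨q, hq⟩)
  rw [this, hl]; rfl

lemma treeDist_getVert {k : ℕ} (hk : k ≤ p.length) : treeDist T u (p.getVert k) = k := by
  rw [← length_eq_treeDist hT (hp.take k), SimpleGraph.Walk.take_length, min_eq_left hk]

lemma treeDist_getVert_end (k : ℕ) : treeDist T (p.getVert k) v = p.length - k := by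
  rw [← length_eq_treeDist hT (hp.drop k), SimpleGraph.Walk.drop_length]

lemma edgeDepth_getVert {k : ℕ} (hk : k < p.length) :
    edgeDepth T u s(p.getVert k, p.getVert (k + 1)) = k + 1 := by
  simp [edgeDepth, treeDist_getVert hT hp hk.le, treeDist_getVert hT hp (Nat.succ_le_of_lt hk)]

lemma mem_pathEdges_iff {e : Sym2 W} : e ∈ pathEdges T u v ↔ e ∈ p.edges := by
  constructor
  · rintro ⟨q, hq, he⟩
    have : q = p := congrArg Subtype.val ((hT.subsingleton_path u v).elim ⟨q, hq⟩ ⟨p, hp⟩)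
    rwa [this] at he
  · exact fun he => ⟨p, hp, he⟩

lemma mem_pathVerts_iff {x : W} : x ∈ pathVerts T u v ↔ x ∈ p.support := by
  constructor
  · rintro ⟨q, hq, he⟩
    have : q = p := congrArg Subtype.val ((hT.subsingleton_path u v).elim ⟨q, hq⟩ ⟨p, hp⟩)
    rwa [this] at he
  · exact fun he => ⟨p, hp, he⟩

lemma mem_pathEdges_getVert_iff {s t : ℕ} (hst : s ≤ t) (ht : t ≤ p.length) {e : Sym2 W} :
    e ∈ pathEdges T (p.getVert s) (p.getVert t) ↔
      ∃ k, s ≤ k ∧ k < t ∧ e = s(p.getVert k, p.getVert (k + 1)) := by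
  have hs : (p.take t).getVert s = p.getVert s := by
    rw [SimpleGraph.Walk.take_getVert, min_eq_right hst]
  rw [← hs, mem_pathEdges_iff hT ((hp.take t).drop s)]
  induction e with
  | h x y =>
    rw [SimpleGraph.Walk.mk_mem_edges_iff_exists]
    simp only [SimpleGraph.Walk.drop_length, SimpleGraph.Walk.take_length,
      SimpleGraph.Walk.drop_getVert, SimpleGraph.Walk.take_getVert]
    constructor
    · rintro ⟨i, hi, h⟩
      refine ⟨s + i, by omega, by omega, ?_⟩
      rw [min_eq_right (by omega), min_eq_right (by omega)] at h
      exact h.symm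
    · rintro ⟨k, hsk, hkt, h⟩
      refine ⟨k - s, by omega, ?_⟩
      rw [← add_assoc, Nat.add_sub_cancel' hsk, min_eq_right hkt.le, min_eq_right hkt, h]

lemma mem_pathEdges_root_iff {t : ℕ} (ht : t ≤ p.length) {e : Sym2 W} :
    e ∈ pathEdges T u (p.getVert t) ↔
      ∃ k < t, e = s(p.getVert k, p.getVert (k + 1)) := by
  have := mem_pathEdges_getVert_iff hT hp (Nat.zero_le t) ht (e := e)
  rw [SimpleGraph.Walk.getVert_zero] at this
  simpa using this

lemma mem_pathEdges_iff_exists {e : Sym2 W} :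
    e ∈ pathEdges T u v ↔ ∃ k < p.length, e = s(p.getVert k, p.getVert (k + 1)) := by
  have := mem_pathEdges_root_iff hT hp le_rfl (e := e)
  rwa [SimpleGraph.Walk.getVert_length] at this

omit hp in
lemma edgeDepth_injOn : Set.InjOn (edgeDepth T u) (pathEdges T u w) := by
  rintro e ⟨p, hp, he⟩ f hf h
  obtain ⟨k, hk, rfl⟩ := (mem_pathEdges_iff_exists hT hp).1 ⟨p, hp, he⟩
  obtain ⟨l, hl, rfl⟩ := (mem_pathEdges_iff_exists hT hp).1 hf
  rw [edgeDepth_getVert hT hp hk, edgeDepth_getVert hT hp hl] at h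
  obtain rfl : k = l := by omega
  rfl

end tree

open Classical in
/-- The edges of depth in `(s, t]` on the path from the root `u` to `w`. -/
noncomputable def rootSegment {W : Type*} {G : SimpleGraph W} [Fintype G.edgeSet]
    (T : G.Subgraph) (u w : W) (s t : ℕ) : Finset G.edgeSet :=
  Finset.univ.filter fun e =>
    (e : Sym2 W) ∈ pathEdges T u w ∧ s < edgeDepth T u e ∧ edgeDepth T u e ≤ t

section segment

variable {W : Type*} {G : SimpleGraph W} [Fintype G.edgeSet] {T : G.Subgraph} {u w : W}

lemma mem_rootSegment {s t : ℕ} {e : G.edgeSet} : e ∈ rootSegment T u w s t ↔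
    (e : Sym2 W) ∈ pathEdges T u w ∧ s < edgeDepth T u e ∧ edgeDepth T u e ≤ t := by
  simp [rootSegment]

lemma card_rootSegment (hT : T.spanningCoe.IsAcyclic) {p : T.spanningCoe.Walk u w} (hp : p.IsPath)
    {s t : ℕ} (ht : t ≤ p.length) : (rootSegment T u w s t).card = t - s := by
  classical
  have hmem : ∀ k < p.length, s(p.getVert k, p.getVert (k + 1)) ∈ G.edgeSet := fun k hk =>
    T.spanningCoe_le (p.adj_getVert_succ hk)
  rw [← Nat.card_Ico]
  symm
  refine Finset.card_bij
    (fun k hk => ⟨s(p.getVert k, p.getVert (k + 1)), hmem k (by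
      have := (Finset.mem_Ico.1 hk).2; omega)⟩) ?_ ?_ ?_
  · intro k hk
    have hk' := Finset.mem_Ico.1 hk
    rw [mem_rootSegment, mem_pathEdges_iff_exists hT hp, edgeDepth_getVert hT hp (by omega)]
    exact ⟨⟨k, by omega, rfl⟩, by omega, by omega⟩
  · intro k hk l hl h
    have hk' := Finset.mem_Ico.1 hk
    have hl' := Finset.mem_Ico.1 hl
    have := congrArg (edgeDepth T u) (congrArg Subtype.val h)
    simp only at this
    rw [edgeDepth_getVert hT hp (by omega), edgeDepth_getVert hT hp (by omega)] at this
    omega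
  · rintro ⟨e, he⟩ h
    rw [mem_rootSegment, mem_pathEdges_iff_exists hT hp] at h
    obtain ⟨⟨k, hk, rfl⟩, h1, h2⟩ := h
    rw [edgeDepth_getVert hT hp hk] at h1 h2
    exact ⟨k, Finset.mem_Ico.2 ⟨by omega, by omega⟩, rfl⟩

end segment

namespace HubNetwork

variable {W : Type*} (N : HubNetwork W)

lemma isAcyclic (u : N.V) : (N.T u).spanningCoe.IsAcyclic :=
  isAcyclic_spanningCoe (N.isTree u).isAcyclic

lemma exists_root_path (u : N.V) {x : W} (hx : x ∈ (N.T u).verts) :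
    ∃ p : (N.T u).spanningCoe.Walk u x, p.IsPath :=
  exists_isPath (N.isTree u).connected (N.terminal_mem u u) hx

lemma treeDist_le_diam (u v : N.V) : treeDist (N.T u) u v ≤ N.diam :=
  (Finset.le_sup (f := fun v : N.V => treeDist (N.T u) u v) (Finset.mem_univ v)).trans
    (Finset.le_sup (f := fun u : N.V => Finset.univ.sup fun v : N.V => treeDist (N.T u) u v)
      (Finset.mem_univ u))

variable {N} {u v : N.V} {p : (N.T u).spanningCoe.Walk u v} (hp : p.IsPath)

include hp in
lemma mem_centralEdges_iff {e : Sym2 W} :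
    e ∈ N.centralEdges u v ↔ ∃ k, 5 * p.length ≤ 12 * k ∧ 12 * (k + 1) ≤ 7 * p.length ∧
      e = s(p.getVert k, p.getVert (k + 1)) := by
  have hT := N.isAcyclic u
  have hl := length_eq_treeDist hT hp
  obtain ⟨q, hq⟩ := N.twelve_dvd u u v
  rw [← hl] at hq
  constructor
  · rintro ⟨a, ha, b, hb, h5, h7, he⟩
    rw [mem_pathVerts_iff hT hp, SimpleGraph.Walk.mem_support_iff_exists_getVert] at ha hb
    obtain ⟨i, rfl, hi⟩ := ha
    obtain ⟨j, rfl, hj⟩ := hb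
    rw [treeDist_getVert hT hp hi, ← hl] at h5
    rw [treeDist_getVert hT hp hj, ← hl] at h7
    obtain ⟨k, h1, h2, h3⟩ := (mem_pathEdges_getVert_iff hT hp (by omega) hj).1 he
    exact ⟨k, by omega, by omega, h3⟩
  · rintro ⟨k, h1, h2, h3⟩
    -- Divisibility by 12 makes the ends of the central part actual nodes, at depths `5q` and `7q`
    -- for length `12q`.
    refine ⟨p.getVert (5 * q), ?_, p.getVert (7 * q), ?_, ?_, ?_, ?_⟩
    · rw [mem_pathVerts_iff hT hp]; exact p.getVert_mem_support _
    · rw [mem_pathVerts_iff hT hp]; exact p.getVert_mem_support _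
    · rw [treeDist_getVert hT hp (by omega), ← hl]; omega
    · rw [treeDist_getVert hT hp (by omega), ← hl]; omega
    · rw [mem_pathEdges_getVert_iff hT hp (by omega) (by omega)]
      exact ⟨k, by omega, by omega, h3⟩

variable [Fintype W]

lemma mem_cut_iff {r : ℕ} {x : W} :
    x ∈ N.cut u r ↔ x ∈ skeletonVerts (N.T u) u ∧ treeDist (N.T u) u x = r := by
  simp [cut]

include hp

/-- The path continues to `v` for at least half of the depth `k`, which is the reach required by the
skeleton. -/
lemma getVert_mem_cut {k : ℕ} (hk : 3 * k ≤ 2 * p.length) : p.getVert k ∈ N.cut u k := by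
  classical
  have hT := N.isAcyclic u
  have hd := treeDist_getVert hT hp (show k ≤ p.length by omega)
  rw [mem_cut_iff]
  refine ⟨⟨mem_verts_of_mem_support (N.terminal_mem u u) p (p.getVert_mem_support k), ?_⟩, hd⟩
  have hdesc : IsDescendant (N.T u) u (p.getVert k) v :=
    ⟨N.terminal_mem u v, p, hp, p.getVert_mem_support k⟩
  have hr : p.length - k ≤ reach (N.T u) u (p.getVert k) := by
    rw [← treeDist_getVert_end hT hp k]
    unfold reach
    exact Finset.le_sup (f := fun x => treeDist (N.T u) (p.getVert k) x)
      (Finset.mem_filter.2 ⟨Finset.mem_univ _, hdesc⟩)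
  rw [hd]
  have h1 : (k : ℝ) ≤ 2 * reach (N.T u) u (p.getVert k) := by
    have : k ≤ 2 * reach (N.T u) u (p.getVert k) := by omega
    exact_mod_cast this
  linarith

end HubNetwork

/-! ### The two record systems of a tree -/

section systems

variable {W : Type*} {G : SimpleGraph W} [Fintype G.edgeSet] {T : G.Subgraph}
  (hT : T.spanningCoe.IsAcyclic) (u : W) (I : Finset ℕ) (K : ℕ → Finset W)

/-- Records for the exploration away from the root: an edge of a layer is compared with the edges
above it, up to the end of the preceding layer. -/
noncomputable def downSystem : RecordSystem G.edgeSet (Σ _ : ℕ, W) where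
  rank e := edgeDepth T u e
  paths := I.sigma K
  base w := rootSegment T u w.2 (layerRadius (w.1 - 1)) (layerRadius w.1)
  body w := rootSegment T u w.2 (layerRadius w.1) (layerRadius (w.1 + 1))
  base_lt w _ a ha b hb := by
    rw [mem_rootSegment] at ha hb
    exact_mod_cast ha.2.2.trans_lt hb.2.1
  rank_injOn w _ a ha b hb h := by
    have ha := (mem_rootSegment.1 (Finset.mem_coe.1 ha)).1
    have hb := (mem_rootSegment.1 (Finset.mem_coe.1 hb)).1
    exact Subtype.ext (edgeDepth_injOn hT ha hb (Int.natCast_inj.1 h))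

/-- Records for the exploration towards the root: an edge of a layer is compared with the edges
below it, up to the end of the following layer. -/
noncomputable def upSystem : RecordSystem G.edgeSet (Σ _ : ℕ, W) where
  rank e := -edgeDepth T u e
  paths := I.sigma K
  base w := rootSegment T u w.2 (layerRadius w.1) (layerRadius (w.1 + 1))
  body w := rootSegment T u w.2 (layerRadius (w.1 - 1)) (layerRadius w.1)
  base_lt w _ a ha b hb := by
    rw [mem_rootSegment] at ha hb
    exact neg_lt_neg (by exact_mod_cast hb.2.2.trans_lt ha.2.1)
  rank_injOn w _ a ha b hb h := by
    have ha := (mem_rootSegment.1 (Finset.mem_coe.1 ha)).1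
    have hb := (mem_rootSegment.1 (Finset.mem_coe.1 hb)).1
    exact Subtype.ext (edgeDepth_injOn hT ha hb (Int.natCast_inj.1 (neg_injective h)))

lemma disjoint_rootSegment {w w' : W} {s t s' t' : ℕ} (h : t ≤ s' ∨ t' ≤ s) :
    Disjoint (rootSegment T u w s t) (rootSegment T u w' s' t') := by
  rw [Finset.disjoint_left]
  intro e he he'
  rw [mem_rootSegment] at he he'
  omega

lemma layerRadius_disjoint {i j : ℕ} (hij : i ≠ j) :
    layerRadius (i + 1) ≤ layerRadius j ∨ layerRadius (j + 1) ≤ layerRadius i := by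
  rcases hij.lt_or_gt with h | h
  · exact Or.inl (layerRadius_strictMono.monotone h)
  · exact Or.inr (layerRadius_strictMono.monotone h)

end systems

namespace HubNetwork

variable {W : Type*} [Fintype W] (N : HubNetwork W)

lemma exists_cut_min (u : N.V) (i : ℕ) :
    ∃ r ∈ Finset.Icc (layerRadius (i + 1)) (layerRadius (i + 2)),
      ∀ r' ∈ Finset.Icc (layerRadius (i + 1)) (layerRadius (i + 2)),
        (N.cut u r).card ≤ (N.cut u r').card :=
  Finset.exists_min_image _ _
    (Finset.nonempty_Icc.2 (layerRadius_strictMono.monotone (Nat.le_succ _)))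

/-- A radius between `layerRadius (i + 1)` and `layerRadius (i + 2)` where the cut is smallest. -/
noncomputable def cutRadius (u : N.V) (i : ℕ) : ℕ := (N.exists_cut_min u i).choose

lemma cutRadius_mem (u : N.V) (i : ℕ) :
    layerRadius (i + 1) ≤ N.cutRadius u i ∧ N.cutRadius u i ≤ layerRadius (i + 2) :=
  Finset.mem_Icc.1 (N.exists_cut_min u i).choose_spec.1

/-- A smallest cut between `layerRadius (i + 1)` and `layerRadius (i + 2)`. -/
noncomputable def minCut (u : N.V) (i : ℕ) : Finset W := N.cut u (N.cutRadius u i)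

lemma card_minCut_le (u : N.V) (i r : ℕ)
    (hr : r ∈ Finset.Icc (layerRadius (i + 1)) (layerRadius (i + 2))) :
    (N.minCut u i).card ≤ (N.cut u r).card :=
  (N.exists_cut_min u i).choose_spec.2 r hr

variable [Fintype N.G.edgeSet]

/-- The records of the tree of `u` for the exploration away from the root. -/
noncomputable def down (u : N.V) : RecordSystem N.G.edgeSet (Σ _ : ℕ, W) :=
  downSystem (N.isAcyclic u) u (layerIndices N.diam) (N.minCut u)

/-- The records of the tree of `u` for the exploration towards the root. -/
noncomputable def up (u : N.V) : RecordSystem N.G.edgeSet (Σ _ : ℕ, W) :=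
  upSystem (N.isAcyclic u) u (layerIndices N.diam) (N.minCut u)

/-- The cut lies at or beyond radius `i + 1`, so the root path to `w` crosses the segment
completely. -/
lemma card_rootSegment_minCut {u : N.V} {i s t : ℕ} {w : W} (hw : w ∈ N.minCut u i)
    (ht : t ≤ layerRadius (i + 1)) : (rootSegment (N.T u) u w s t).card = t - s := by
  obtain ⟨hs, hd⟩ := mem_cut_iff.1 hw
  obtain ⟨p, hp⟩ := N.exists_root_path u hs.1
  refine card_rootSegment (N.isAcyclic u) hp ?_
  rw [length_eq_treeDist (N.isAcyclic u) hp, hd]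
  exact ht.trans (N.cutRadius_mem u i).1

lemma one_le_of_mem_layerIndices {D i : ℕ} (h : i ∈ layerIndices D) : 1 ≤ i :=
  (Finset.mem_Icc.1 h).1

lemma down_card_body_le (u : N.V) : ∀ i ∈ layerIndices N.diam, ∀ w ∈ N.minCut u i,
    ((N.down u).body ⟨i, w⟩).card ≤ 4 * ((N.down u).base ⟨i, w⟩).card := by
  intro i hi w hw
  obtain ⟨j, rfl⟩ : ∃ j, i = j + 1 := ⟨i - 1, by have := one_le_of_mem_layerIndices hi; omega⟩
  simp only [down, downSystem]
  rw [N.card_rootSegment_minCut hw le_rfl,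
    N.card_rootSegment_minCut hw (layerRadius_strictMono.monotone (Nat.le_succ _))]
  exact (layerRadius_width_le j).1

lemma up_card_body_le (u : N.V) : ∀ i ∈ layerIndices N.diam, ∀ w ∈ N.minCut u i,
    ((N.up u).body ⟨i, w⟩).card ≤ 4 * ((N.up u).base ⟨i, w⟩).card := by
  intro i hi w hw
  obtain ⟨j, rfl⟩ : ∃ j, i = j + 1 := ⟨i - 1, by have := one_le_of_mem_layerIndices hi; omega⟩
  simp only [up, upSystem]
  rw [N.card_rootSegment_minCut hw le_rfl,
    N.card_rootSegment_minCut hw (layerRadius_strictMono.monotone (Nat.le_succ _))]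
  exact (layerRadius_width_le j).2

lemma down_disjoint_base (u : N.V) : ∀ i ∈ layerIndices N.diam, ∀ j ∈ layerIndices N.diam, i ≠ j →
    ∀ w ∈ N.minCut u i, ∀ w' ∈ N.minCut u j,
      Disjoint ((N.down u).base ⟨i, w⟩) ((N.down u).base ⟨j, w'⟩) := by
  intro i hi j hj hij w _ w' _
  have hi := one_le_of_mem_layerIndices hi
  have hj := one_le_of_mem_layerIndices hj
  refine disjoint_rootSegment _ ?_
  have := layerRadius_disjoint (show i - 1 ≠ j - 1 by omega)
  rwa [Nat.sub_add_cancel hi, Nat.sub_add_cancel hj] at this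

lemma up_disjoint_base (u : N.V) : ∀ i ∈ layerIndices N.diam, ∀ j ∈ layerIndices N.diam, i ≠ j →
    ∀ w ∈ N.minCut u i, ∀ w' ∈ N.minCut u j,
      Disjoint ((N.up u).base ⟨i, w⟩) ((N.up u).base ⟨j, w'⟩) :=
  fun _ _ _ _ hij _ _ _ _ => disjoint_rootSegment _ (layerRadius_disjoint hij)

open Classical in
/-- The edges of depth less than `20` on central subpaths. -/
noncomputable def shallowEdges (u : N.V) : Finset N.G.edgeSet :=
  Finset.univ.filter fun e => (∃ v : N.V, (e : Sym2 W) ∈ N.centralEdges u v) ∧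
    edgeDepth (N.T u) u e < 20

/-- Each edge is sent to its lower endpoint, which lies in a cut because central edges end within
`7/12 ≤ 2/3` of the path. The lower endpoint determines the edge in the rooted tree. -/
lemma card_shallowEdges_le (u : N.V) :
    (N.shallowEdges u).card ≤ ∑ r ∈ Finset.range 20, (N.cut u r).card := by
  classical
  have hT := N.isAcyclic u
  refine le_trans ?_ (Finset.card_biUnion_le (s := Finset.range 20) (t := N.cut u))
  refine Finset.card_le_card_of_forall_subsingleton
    (fun (e : N.G.edgeSet) (x : W) => (e : Sym2 W) ∈ pathEdges (N.T u) u x ∧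
      edgeDepth (N.T u) u e = treeDist (N.T u) u x) ?_ ?_
  · intro e he
    obtain ⟨-, ⟨v, hv⟩, h20⟩ := Finset.mem_filter.1 he
    obtain ⟨p, hp⟩ := N.exists_root_path u (N.terminal_mem u v)
    obtain ⟨k, h1, h2, h3⟩ := (mem_centralEdges_iff hp).1 hv
    have hdep := edgeDepth_getVert hT hp (show k < p.length by omega)
    rw [h3, hdep] at h20
    refine ⟨p.getVert (k + 1), Finset.mem_biUnion.2 ⟨k + 1, Finset.mem_range.2 h20,
      getVert_mem_cut hp (by omega)⟩, ?_, ?_⟩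
    · exact (mem_pathEdges_root_iff hT hp (by omega)).2 ⟨k, by omega, h3⟩
    · rw [h3, hdep, treeDist_getVert hT hp (by omega)]
  · rintro x - e ⟨-, he, hed⟩ f ⟨-, hf, hfd⟩
    exact Subtype.ext (edgeDepth_injOn hT he hf (hed.trans hfd.symm))

variable {N}

/-- The smallest value of a central subpath is attained at shallow depth or at a record. -/
lemma mem_of_mem_hubSet {ρ : N.G.edgeSet → unitInterval} {u : N.V} {η : N.G.edgeSet}
    (h : η ∈ N.hubSet ρ u) :
    η ∈ N.shallowEdges u ∨ (N.down u).IsRecord ρ η ∨ (N.up u).IsRecord ρ η := by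
  classical
  have hT := N.isAcyclic u
  obtain ⟨v, -, hη, hmin⟩ := h
  obtain ⟨p, hp⟩ := N.exists_root_path u (N.terminal_mem u v)
  have hlD : p.length ≤ N.diam := by
    rw [length_eq_treeDist hT hp]; exact N.treeDist_le_diam u v
  obtain ⟨k, h1, h2, h3⟩ := (mem_centralEdges_iff hp).1 hη
  have hdep := edgeDepth_getVert hT hp (show k < p.length by omega)
  rw [← h3] at hdep
  by_cases h20 : k + 1 < 20
  · exact Or.inl (Finset.mem_filter.2 ⟨Finset.mem_univ _, ⟨v, hη⟩, hdep ▸ h20⟩)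
  right
  obtain ⟨j, hj3, hj1, hj2⟩ := exists_layer (show 20 ≤ k + 1 by omega)
  have hj4 := mem_layerIndices hj1 (show 12 * (k + 1) ≤ 7 * N.diam by omega)
  -- The path to the cut node is an initial part of `P_u(v)`, so its edges with depth in the central
  -- range compete with `η`. The lower bound uses depth minus 1, the depth of the upper endpoint.
  have hlow : ∀ i s t, N.cutRadius u i ≤ p.length → ∀ f : N.G.edgeSet,
      f ∈ rootSegment (N.T u) u (p.getVert (N.cutRadius u i)) s t →
      5 * p.length ≤ 12 * (edgeDepth (N.T u) u f - 1) →
      12 * edgeDepth (N.T u) u f ≤ 7 * p.length → ρ η ≤ ρ f := by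
    intro i s t hr f hf h5 h7
    obtain ⟨l, hl, hfe⟩ := (mem_pathEdges_root_iff hT hp hr).1 (mem_rootSegment.1 hf).1
    have hfd := edgeDepth_getVert hT hp (show l < p.length by omega)
    rw [← hfe] at hfd
    rw [hfd] at h5 h7
    exact hmin f ((mem_centralEdges_iff hp).2 ⟨l, by omega, h7, hfe⟩)
  -- Compare towards the midpoint: in either half the layer of `η` and its neighbour stay central on
  -- that side.
  rcases le_total p.length (2 * (k + 1)) with hd | hd
  · left
    obtain ⟨ha, hb⟩ := layer_below (by omega) hj1 h2 hd hj2 (by omega)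
    have hc := N.cutRadius_mem u j
    refine ⟨⟨j, p.getVert (N.cutRadius u j)⟩, ?_, ?_, ?_⟩
    · exact Finset.mem_sigma.2 ⟨show j ∈ layerIndices N.diam from
        Finset.mem_Icc.2 ⟨by omega, by omega⟩, show _ ∈ N.cut u (N.cutRadius u j) from
        getVert_mem_cut hp (by omega)⟩
    · refine mem_rootSegment.2 ⟨?_, by rw [hdep]; exact hj1, by rw [hdep]; exact hj2⟩
      exact (mem_pathEdges_root_iff hT hp (by omega)).2 ⟨k, by omega, h3⟩
    · intro f hf hlt
      have hlt' : edgeDepth (N.T u) u f < edgeDepth (N.T u) u η := Int.ofNat_lt.1 hlt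
      rw [hdep] at hlt'
      have hmono := layerRadius_strictMono.monotone (show j - 1 ≤ j by omega)
      rcases hf with hf | hf
      · have hf' := (mem_rootSegment.1 hf).2.1
        simp only at hf'
        exact hlow j _ _ (by omega) f hf (by omega) (by omega)
      · have hf' := (mem_rootSegment.1 hf).2.1
        simp only at hf'
        exact hlow j _ _ (by omega) f hf (by omega) (by omega)
  · right
    obtain ⟨ha, hb⟩ : 12 * layerRadius (j + 1 + 1) ≤ 7 * p.length ∧
        3 * layerRadius (j + 1 + 2) ≤ 2 * p.length := layer_above hj1 hd
    have hc := N.cutRadius_mem u (j + 1)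
    have hmono := layerRadius_strictMono.monotone (show j + 1 ≤ j + 1 + 1 by omega)
    refine ⟨⟨j + 1, p.getVert (N.cutRadius u (j + 1))⟩, ?_, ?_, ?_⟩
    · exact Finset.mem_sigma.2 ⟨show j + 1 ∈ layerIndices N.diam from
        Finset.mem_Icc.2 ⟨by omega, by omega⟩, show _ ∈ N.cut u (N.cutRadius u (j + 1)) from
        getVert_mem_cut hp (by omega)⟩
    · refine mem_rootSegment.2 ⟨?_, by rw [hdep]; exact hj1, by rw [hdep]; exact hj2⟩
      exact (mem_pathEdges_root_iff hT hp (by omega)).2 ⟨k, by omega, h3⟩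
    · intro f hf hlt
      have hlt' : edgeDepth (N.T u) u η < edgeDepth (N.T u) u f :=
        Int.ofNat_lt.1 (neg_lt_neg_iff.1 hlt)
      rw [hdep] at hlt'
      rcases hf with hf | hf
      · have hf' := (mem_rootSegment.1 hf).2.2
        simp only at hf'
        exact hlow (j + 1) _ _ (by omega) f hf (by omega) (by omega)
      · have hf' := (mem_rootSegment.1 hf).2.2
        simp only at hf'
        exact hlow (j + 1) _ _ (by omega) f hf (by omega) (by omega)

lemma ncard_hubSet_le (ρ : N.G.edgeSet → unitInterval) (u : N.V) :
    (N.hubSet ρ u).ncard ≤ ∑ r ∈ Finset.range 20, (N.cut u r).card +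
      ((N.down u).recordCount Finset.univ ρ + (N.up u).recordCount Finset.univ ρ) := by
  classical
  have hsub : N.hubSet ρ u ⊆ ((N.shallowEdges u ∪
      ((Finset.univ.filter fun e => (N.down u).IsRecord ρ e) ∪
        Finset.univ.filter fun e => (N.up u).IsRecord ρ e) : Finset N.G.edgeSet) :
          Set N.G.edgeSet) := by
    intro η hη
    simpa using mem_of_mem_hubSet hη
  refine (Set.ncard_le_ncard hsub (Finset.finite_toSet _)).trans ?_
  rw [Set.ncard_coe_finset]
  refine (Finset.card_union_le _ _).trans (add_le_add (N.card_shallowEdges_le u) ?_)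
  refine (Finset.card_union_le _ _).trans (le_of_eq ?_)
  unfold RecordSystem.recordCount
  congr!

end HubNetwork

/-! ### From layer means to admissible families -/

lemma card_layerIndices_le (D : ℕ) : ((layerIndices D).card : ℝ) ≤ 16 * Real.log D := by
  rw [layerIndices, Nat.card_Icc, Nat.add_sub_cancel]
  exact Nat.floor_le (mul_nonneg (by norm_num) (Real.log_natCast_nonneg D))

lemma le_maxLogSum {D n : ℕ} (l : ℕ → ℕ) {γ : ℕ → ℕ} (hγ : γ ∈ admissibleFamilies D n) :
    ∑ i ∈ layerIndices D, (l i : ℝ) * Real.log (γ i) ≤ maxLogSum D n l := by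
  refine le_csSup ?_ ⟨γ, hγ, rfl⟩
  -- Each entry of an admissible family is at most the bound on the whole sum, so the supremum is
  -- over a bounded set.
  refine ⟨∑ i ∈ layerIndices D, (l i : ℝ) * Real.log (2112 * Real.log D + 528 * Real.log n), ?_⟩
  rintro _ ⟨δ, ⟨hpos, hsum⟩, rfl⟩
  refine Finset.sum_le_sum fun i hi => mul_le_mul_of_nonneg_left ?_ (Nat.cast_nonneg _)
  refine Real.log_le_log (by exact_mod_cast hpos i hi) (le_trans ?_ hsum.le)
  exact Finset.single_le_sum (f := fun i => (δ i : ℝ)) (fun _ _ => Nat.cast_nonneg _) hi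

/-- Two families of layer bounds with small sums are dominated by one admissible family. -/
lemma sum_log_le_maxLogSum {D n : ℕ} (hn : 2 ≤ n) (k : ℕ → ℕ) {x y : ℕ → ℝ}
    (hx : ∀ i, 0 ≤ x i) (hy : ∀ i, 0 ≤ y i)
    (hxs : ∑ i ∈ layerIndices D, x i < 16 * Real.log n + 8 * (layerIndices D).card)
    (hys : ∑ i ∈ layerIndices D, y i < 16 * Real.log n + 8 * (layerIndices D).card) :
    ∑ i ∈ layerIndices D, (k i : ℝ) * Real.log (1 + x i) +
      ∑ i ∈ layerIndices D, (k i : ℝ) * Real.log (1 + y i) ≤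
        maxLogSum D n fun i => 2 * k i := by
  have hfl : ∀ i, ((⌊1 + x i + y i⌋₊ + 1 : ℕ) : ℝ) ≤ 2 + x i + y i := fun i => by
    have := Nat.floor_le (show 0 ≤ 1 + x i + y i by linarith [hx i, hy i])
    push_cast; linarith
  have hfu : ∀ i, 1 + x i + y i ≤ ((⌊1 + x i + y i⌋₊ + 1 : ℕ) : ℝ) := fun i => by
    have := Nat.lt_floor_add_one (1 + x i + y i)
    push_cast; linarith
  have hlogn : 0 < Real.log n := Real.log_pos (by exact_mod_cast hn)
  have hlogD : 0 ≤ Real.log D := Real.log_natCast_nonneg D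
  -- One integer `γ i` dominates both `1 + x i` and `1 + y i`, whence the weight `2 k i`. The sum is
  -- below `18 · 16 ln D + 32 ln n`, well within the allowance.
  refine le_trans ?_ (le_maxLogSum (D := D) (n := n) (fun i => 2 * k i)
    (γ := fun i => ⌊1 + x i + y i⌋₊ + 1) ⟨fun _ _ => Nat.succ_pos _, ?_⟩)
  · rw [← Finset.sum_add_distrib]
    refine Finset.sum_le_sum fun i _ => ?_
    have h1 : Real.log (1 + x i) ≤ Real.log ((⌊1 + x i + y i⌋₊ + 1 : ℕ) : ℝ) :=
      Real.log_le_log (by linarith [hx i]) (by linarith [hfu i, hy i])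
    have h2 : Real.log (1 + y i) ≤ Real.log ((⌊1 + x i + y i⌋₊ + 1 : ℕ) : ℝ) :=
      Real.log_le_log (by linarith [hy i]) (by linarith [hfu i, hx i])
    have hk : (0 : ℝ) ≤ k i := Nat.cast_nonneg _
    have := mul_le_mul_of_nonneg_left (add_le_add h1 h2) hk
    push_cast at this ⊢
    linarith
  · have hcard := card_layerIndices_le D
    calc _ ≤ ∑ i ∈ layerIndices D, (2 + x i + y i) := Finset.sum_le_sum fun i _ => hfl i
      _ = 2 * (layerIndices D).card + ∑ i ∈ layerIndices D, x i + ∑ i ∈ layerIndices D, y i := by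
          rw [Finset.sum_add_distrib, Finset.sum_add_distrib, Finset.sum_const, nsmul_eq_mul]
          ring
      _ < _ := by linarith

/-! ### Union bound over the terminals -/

namespace HubNetwork

variable {W : Type*} [Fintype W] (N : HubNetwork W)

/-- The bound on the size of the edge hub set of a terminal. -/
noncomputable def hubBound (u : N.V) : ℝ :=
  2 * ∑ r ∈ Finset.range 20, ((N.cut u r).card : ℝ) + 24 * Real.log N.V.card +
    2 * maxLogSum N.diam N.V.card fun i => 2 * (N.minCut u i).card

lemma measure_hubSet_bad_le [Fintype N.G.edgeSet] (hn : 2 ≤ N.V.card) (u : N.V) :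
    (Measure.pi fun _ : N.G.edgeSet => (volume : Measure unitInterval))
      {ρ | ¬ ((N.hubSet ρ u).ncard : ℝ) ≤ N.hubBound u} ≤
        ENNReal.ofReal (4 / (N.V.card : ℝ) ^ 2) := by
  have hn0 : (0 : ℝ) < N.V.card := by exact_mod_cast (show 0 < N.V.card by omega)
  have hd := (N.down u).measure_records_bad_le rfl hn0 (N.down_card_body_le u)
    (N.down_disjoint_base u)
  have hu := (N.up u).measure_records_bad_le rfl hn0 (N.up_card_body_le u)
    (N.up_disjoint_base u)
  have hsum : ENNReal.ofReal (4 / (N.V.card : ℝ) ^ 2) =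
      ENNReal.ofReal (2 / (N.V.card : ℝ) ^ 2) + ENNReal.ofReal (2 / (N.V.card : ℝ) ^ 2) := by
    rw [← ENNReal.ofReal_add (by positivity) (by positivity)]
    congr 1; ring
  rw [hsum]
  refine le_trans (measure_mono ?_) ((measure_union_le _ _).trans (add_le_add hd hu))
  intro ρ hρ
  by_contra hc
  simp only [Set.mem_union, Set.mem_ofPred_eq, not_or, not_not] at hc
  obtain ⟨⟨hd1, hd2⟩, hu1, hu2⟩ := hc
  refine hρ ?_
  have hmax := sum_log_le_maxLogSum hn (fun i => (N.minCut u i).card)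
    ((N.down u).layerMean_nonneg (N.minCut u) · ρ) ((N.up u).layerMean_nonneg (N.minCut u) · ρ)
    hd2 hu2
  have hlogn : 0 ≤ Real.log N.V.card := Real.log_natCast_nonneg _
  have hcount : ((N.hubSet ρ u).ncard : ℝ) ≤ ∑ r ∈ Finset.range 20, ((N.cut u r).card : ℝ) +
      ((N.down u).recordCount Finset.univ ρ + (N.up u).recordCount Finset.univ ρ) := by
    exact_mod_cast ncard_hubSet_le ρ u
  have hcut : 0 ≤ ∑ r ∈ Finset.range 20, ((N.cut u r).card : ℝ) :=
    Finset.sum_nonneg fun _ _ => Nat.cast_nonneg _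
  -- The bound `ln 2 ≥ 1/2` produces the factor 2 before the maximum.
  have hl2 : (1 / 2 : ℝ) ≤ Real.log 2 := by linarith [Real.log_two_gt_d9]
  have hrec : (((N.down u).recordCount Finset.univ ρ : ℝ) +
      (N.up u).recordCount Finset.univ ρ) * (1 / 2) ≤
      4 * Real.log N.V.card + maxLogSum N.diam N.V.card fun i => 2 * (N.minCut u i).card := by
    calc _ ≤ (((N.down u).recordCount Finset.univ ρ : ℝ) +
          (N.up u).recordCount Finset.univ ρ) * Real.log 2 := by gcongr
      _ ≤ _ := by linarith
  unfold hubBound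
  linarith

end HubNetwork

theorem mainTheorem2 {W : Type*} [Fintype W] (N : HubNetwork W) :
    ∃ l : N.V → ℕ → ℕ,
      (∀ u : N.V, ∀ i : ℕ, 1 ≤ i →
        ∀ r ∈ Finset.Icc (layerRadius (i + 1)) (layerRadius (i + 2)),
          l u i ≤ 2 * (N.cut u r).card) ∧
      1 - 8 / (N.V.card : ℝ) ≤
        N.edgeLaw.real {ρ | ∀ u : N.V,
          ((N.hubSet ρ u).ncard : ℝ) ≤
            2 * ∑ r ∈ Finset.range 20, ((N.cut u r).card : ℝ) +
              24 * Real.log N.V.card + 2 * maxLogSum N.diam N.V.card (l u)} := by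
  classical
  refine ⟨fun u i => 2 * (N.minCut u i).card, fun u i _ r hr =>
    Nat.mul_le_mul_left 2 (N.card_minCut_le u i r hr), ?_⟩
  change 1 - 8 / (N.V.card : ℝ) ≤
    N.edgeLaw.real {ρ | ∀ u : N.V, ((N.hubSet ρ u).ncard : ℝ) ≤ N.hubBound u}
  have hprob : IsProbabilityMeasure N.edgeLaw := by unfold HubNetwork.edgeLaw; infer_instance
  -- For `n = 0` the quotient `8 / 0` is 0, so the claim demands probability 1; it holds because
  -- there are no terminals.
  rcases Nat.eq_zero_or_pos N.V.card with h0 | hpos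
  · have hempty : IsEmpty N.V := by
      rw [Finset.card_eq_zero] at h0
      exact ⟨fun u => by have := u.2; simp [h0] at this⟩
    have : {ρ | ∀ u : N.V, ((N.hubSet ρ u).ncard : ℝ) ≤ N.hubBound u} = Set.univ :=
      Set.eq_univ_of_forall fun ρ u => hempty.elim u
    rw [this, h0]
    simp
  have hn0 : (0 : ℝ) < N.V.card := by exact_mod_cast hpos
  by_cases hn : N.V.card < 2
  · have h1 : N.V.card = 1 := by omega
    refine le_trans ?_ measureReal_nonneg
    rw [h1]; norm_num
  have hbad : N.edgeLaw {ρ | ∀ u : N.V, ((N.hubSet ρ u).ncard : ℝ) ≤ N.hubBound u}ᶜ ≤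
      ENNReal.ofReal (4 / (N.V.card : ℝ)) := by
    have hcompl : {ρ | ∀ u : N.V, ((N.hubSet ρ u).ncard : ℝ) ≤ N.hubBound u}ᶜ =
        ⋃ u : N.V, {ρ | ¬ ((N.hubSet ρ u).ncard : ℝ) ≤ N.hubBound u} := by
      ext ρ; simp
    rw [hcompl]
    refine (measure_iUnion_fintype_le _ _).trans ?_
    refine (Finset.sum_le_sum fun u _ => N.measure_hubSet_bad_le (by omega) u).trans ?_
    rw [Finset.sum_const, Finset.card_univ, Fintype.card_coe, nsmul_eq_mul,
      ← ENNReal.ofReal_natCast, ← ENNReal.ofReal_mul hn0.le]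
    refine ENNReal.ofReal_le_ofReal (le_of_eq ?_)
    field_simp
  -- Subadditivity gives this inequality without measurability of the event.
  have hle : (1 : ℝ) ≤
      N.edgeLaw.real {ρ | ∀ u : N.V, ((N.hubSet ρ u).ncard : ℝ) ≤ N.hubBound u} +
      N.edgeLaw.real {ρ | ∀ u : N.V, ((N.hubSet ρ u).ncard : ℝ) ≤ N.hubBound u}ᶜ := by
    have := measureReal_union_le (μ := N.edgeLaw)
      {ρ | ∀ u : N.V, ((N.hubSet ρ u).ncard : ℝ) ≤ N.hubBound u}
      {ρ | ∀ u : N.V, ((N.hubSet ρ u).ncard : ℝ) ≤ N.hubBound u}ᶜ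
    rwa [Set.union_compl_self, probReal_univ] at this
  have hbad' : N.edgeLaw.real {ρ | ∀ u : N.V, ((N.hubSet ρ u).ncard : ℝ) ≤ N.hubBound u}ᶜ ≤
      4 / N.V.card := ENNReal.toReal_le_of_le_ofReal (by positivity) hbad
  have : (4 : ℝ) / N.V.card ≤ 8 / N.V.card := by gcongr; norm_num
  linarith
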